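/- Let $R$ be a commutative ring with identity and let $C$ be a semidualizing $R$-module: $C$ has a projective resolution by finitely generated projective modules, the homothety map $R\to \mathrm{Hom}_R(C,C)$ is an isomorphism, and $\mathrm{Ext}_R^i(C,C)=0$ for all $i\ge 1$. Let $\mathrm{Ch}(R)$ be the category of (unbounded) complexes of $R$-modules. Let $\mathcal P$ be the class of projective $R$-modules, $\mathcal P_C$ the class of modules isomorphic to $C\otimes_R P$ with $P$ projective, and $\mathcal F_C$ the class of modules isomorphic to $C\otimes_R F$ with $F$ flat. For a class $\mathcal X$ of modules, let $\widetilde{\mathcal X}$ be the class of exact complexes all of whose cycle modules lie in $\mathcal X$. A complex $G$ is called $D_C$-projective if there is an exact sequence in $\mathrm{Ch}(R)$ $$\cdots\to P_1\to P_0\xrightarrow{f_0} Q_{-1}\to Q_{-2}\to\cdots$$ with all $P_i\in\widetilde{\mathcal P}$ and all $Q_i\in\widetilde{\mathcal P_C}$ that stays exact under $\mathrm{Hom}(-,H)$ for every $H\in\widetilde{\mathcal F_C}$, and such that $G\cong \mathrm{Im} f_0$. For a complex $X$, let $D_C\text{-pd}(X)$ (resp. $\mathcal P_C\text{-pd}(X)$)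 be the least integer $n\ge 0$ for which there is an exact sequence $0\to G_n\to\cdots\to G_0\to X\to 0$ in $\mathrm{Ch}(R)$ with all $G_i$ $D_C$-projective (resp. in $\widetilde{\mathcal P_C}$), and $\infty$ if there is none. Let $X\in \mathrm{Ch}(R)$ with $D_C\text{-pd}(X)=n<\infty$. Then: (1) There is an exact sequence $0\to X\to Y\to G\to 0$ in $\mathrm{Ch}(R)$ with $G$ $D_C$-projective and $\mathcal P_C\text{-pd}(Y)=n$. (2) $X$ has a special $D_C$-projective precover, i.e. there is an exact sequence $0\to K\to G\to X\to 0$ in $\mathrm{Ch}(R)$ with $G$ $D_C$-projective and $\mathrm{Ext}^1(G',K)=0$ for every $D_C$-projective complex $G'$, such that moreover $\mathcal P_C\text{-pd}(K)=n-1$ if $n>0$, and $K=0$ if $n=0$. -/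

import Mathlib

open CategoryTheory CategoryTheory.Limits
open scoped TensorProduct

universe u v

namespace RelDing

noncomputable section

section Abelian

variable {A : Type u} [Category.{v} A] [Abelian A]

/-- A (cohomologically indexed, unbounded) sequence `E` in `A` is `Hom(-, 𝓑)`-exact: for every `B`
in `𝓑` and every `i`, the sequence of abelian groups
`Hom(E (i+1), B) ⟶ Hom(E i, B) ⟶ Hom(E (i-1), B)` is exact at `Hom(E i, B)`. -/
def HomExact (𝓑 : ObjectProperty A) (E : CochainComplex A ℤ) : Prop :=
  ∀ B : A, 𝓑 B → ∀ i : ℤ,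
    Function.Exact (fun h : E.X (i + 1) ⟶ B => E.d i (i + 1) ≫ h)
      (fun g : E.X i ⟶ B => E.d (i - 1) i ≫ g)

/-- `X` is the image of `P₀ ⟶ Q₋₁` in a `Hom(-, 𝓕)`-exact exact sequence
`⋯ ⟶ P₁ ⟶ P₀ ⟶ Q₋₁ ⟶ Q₋₂ ⟶ ⋯` with all `Pᵢ` in `𝓟` and all `Qᵢ` in `𝓠`. The sequence is
recorded as an acyclic cochain complex `E`, where `Pᵢ` is `E.X (-1 - i)` for `i ≥ 0` and `Qᵢ` is
`E.X (-1 - i)` for `i < 0`; thus `P₀ ⟶ Q₋₁` is `E.d (-1) 0`. -/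
def HasCompleteResolution (𝓟 𝓠 𝓕 : ObjectProperty A) : ObjectProperty A := fun X =>
  ∃ E : CochainComplex A ℤ,
    E.Acyclic ∧ HomExact 𝓕 E ∧ (∀ i : ℤ, i < 0 → 𝓟 (E.X i)) ∧ (∀ i : ℤ, 0 ≤ i → 𝓠 (E.X i)) ∧
      Nonempty (X ≅ image (E.d (-1) 0))

/-- There is an exact sequence `0 ⟶ Gₙ ⟶ ⋯ ⟶ G₁ ⟶ G₀ ⟶ X ⟶ 0` with all `Gᵢ` in `𝓧`. It is recorded
as an acyclic chain complex `E` in nonnegative degrees with `E.X 0 ≅ X`, with `Gᵢ = E.X (i + 1)`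
for `i ≤ n`, and with zero objects in the degrees above `n + 1`. -/
def HasResolutionOfLength (𝓧 : ObjectProperty A) (X : A) (n : ℕ) : Prop :=
  ∃ E : ChainComplex A ℕ,
    E.Acyclic ∧ Nonempty (E.X 0 ≅ X) ∧ (∀ i : ℕ, i ≤ n → 𝓧 (E.X (i + 1))) ∧
      ∀ i : ℕ, n < i → IsZero (E.X (i + 1))

/-- The `𝓧`-dimension of `X`: the least `n` such that there is an exact sequence
`0 ⟶ Gₙ ⟶ ⋯ ⟶ G₀ ⟶ X ⟶ 0` with all `Gᵢ` in `𝓧`, and `∞` if there is none. -/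
def resolutionDim (𝓧 : ObjectProperty A) (X : A) : ℕ∞ :=
  ⨅ (n : ℕ) (_ : HasResolutionOfLength 𝓧 X n), (n : ℕ∞)

/-- `0 ⟶ K ⟶ F ⟶ X ⟶ 0` is a special `𝓕`-precover of `X`: it is a short exact sequence with `F` in
`𝓕` and `Ext¹(F', K) = 0` for all `F'` in `𝓕`. -/
structure IsSpecialPrecover [HasExt.{v} A] (𝓕 : ObjectProperty A) {K F X : A} (i : K ⟶ F)
    (p : F ⟶ X) : Prop where
  zero : i ≫ p = 0
  shortExact : (ShortComplex.mk i p zero).ShortExact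
  mem : 𝓕 F
  ext_one : ∀ F' : A, 𝓕 F' → Subsingleton (Abelian.Ext F' K 1)

end Abelian

section Modules

variable (R : Type u) [CommRing R]

/-- The category of complexes of `R`-modules, `⋯ ⟶ X¹ ⟶ X⁰ ⟶ X⁻¹ ⟶ ⋯`. -/
abbrev Ch : Type (u + 1) := ChainComplex (ModuleCat.{u} R) ℤ

variable {R}

/-- Semidualizing modules. -/
structure IsSemidualizing (C : ModuleCat.{u} R) : Prop where
  /-- `C` has a degreewise finitely generated projective resolution. -/
  exists_resolution : ∃ P : ProjectiveResolution C, ∀ n : ℕ, Module.Finite R (P.complex.X n)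
  /-- The homothety map `R ⟶ Hom(C, C)` is an isomorphism. -/
  bijective_homothety : Function.Bijective (LinearMap.lsmul R C)
  /-- `Extⁱ(C, C) = 0` for all `i ≥ 1`. -/
  ext_self : ∀ i : ℕ, 1 ≤ i → Subsingleton (Abelian.Ext C C i)

/-- The class of projective modules. -/
def projMod : ObjectProperty (ModuleCat.{u} R) := fun M => Module.Projective R M

/-- The class of `C`-projective modules, i.e. the modules isomorphic to `C ⊗ P` with `P`
projective. -/
def cProjMod (C : ModuleCat.{u} R) : ObjectProperty (ModuleCat.{u} R) := fun M =>
  ∃ P : ModuleCat.{u} R, Module.Projective R P ∧ Nonempty (M ≃ₗ[R] (C ⊗[R] P))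

/-- The class of `C`-flat modules, i.e. the modules isomorphic to `C ⊗ F` with `F` flat. -/
def cFlatMod (C : ModuleCat.{u} R) : ObjectProperty (ModuleCat.{u} R) := fun M =>
  ∃ F : ModuleCat.{u} R, Module.Flat R F ∧ Nonempty (M ≃ₗ[R] (C ⊗[R] F))

/-- For a class `𝓧` of modules, the class of `𝓧`-complexes: the exact complexes all of whose cycle
modules lie in `𝓧`. -/
def tilde (𝓧 : ObjectProperty (ModuleCat.{u} R)) : ObjectProperty (Ch R) := fun X =>
  X.Acyclic ∧ ∀ i : ℤ, 𝓧 (X.cycles i)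

/-- The class of `D_C`-projective complexes. -/
def DCProjective (C : ModuleCat.{u} R) : ObjectProperty (Ch R) :=
  HasCompleteResolution (tilde projMod) (tilde (cProjMod C)) (tilde (cFlatMod C))

/-- The `D_C`-projective dimension of a complex. -/
def dcPd (C : ModuleCat.{u} R) (X : Ch R) : ℕ∞ := resolutionDim (DCProjective C) X

/-- The `𝓟_C`-projective dimension of a complex. -/
def pcPd (C : ModuleCat.{u} R) (X : Ch R) : ℕ∞ := resolutionDim (tilde (cProjMod C)) X

end Modules

end

end RelDing

/-! The argument is Auslander–Buchweitz approximation, run axiomatically. `IsRelativeGorenstein 𝓠 𝓓`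
records what it needs: 𝓓 contains 𝓠, is closed under extensions and kernels of epimorphisms, has no
higher Ext into 𝓠, and each of its objects embeds into one of 𝓠 with cokernel in 𝓓. Then
`exists_hull_and_precover` builds hull and precover together by induction on the length. Dimensions
agree because a hull or precover of given 𝓠-length yields a 𝓓-resolution of X of matching length.

The axioms hold for any class `HasCompleteResolution 𝓟 𝓠 𝓕` with 𝓟 and 𝓠 Ext-orthogonal to 𝓕, 𝓠 ⊆ 𝓕
closed under finite sums, and enough objects in 𝓟. Here only the right half of a complete resolution
carries information: X has one iff it lies in a class that is Ext-orthogonal to 𝓕 and stable under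
some choice of cosyzygies in 𝓠 (`IsCosyzygyClosed`).

What remains is that Ext vanishes from $\widetilde{\mathcal P_C}$ to $\widetilde{\mathcal F_C}$. For
modules, Ext(C ⊗ P, C ⊗ F) reduces to Ext(C, C) by finite generation, flatness and projectivity. For
complexes, Ext-orthogonal cycles make X a retract of a disc complex, and vanishing of Ext out of a
disc complex is checked degreewise. -/

open scoped ZeroObject

namespace RelDing

/-! ### Short exact sequences in an abelian category -/

section Abelian

variable {A : Type u} [Category.{v} A] [Abelian A]

/-- There is a short exact sequence `0 ⟶ X ⟶ Y ⟶ Z ⟶ 0`. -/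
def IsSES (X Y Z : A) : Prop :=
  ∃ (f : X ⟶ Y) (g : Y ⟶ Z) (w : f ≫ g = 0), (ShortComplex.mk f g w).ShortExact

lemma isSES_iff_op {X Y Z : A} :
    IsSES X Y Z ↔ IsSES (Opposite.op Z) (Opposite.op Y) (Opposite.op X) := by
  constructor
  · rintro ⟨f, g, w, h⟩
    exact ⟨g.op, f.op, by rw [← op_comp, w, op_zero], h.op⟩
  · rintro ⟨f, g, w, h⟩
    exact ⟨g.unop, f.unop, by rw [← unop_comp, w, unop_zero], h.unop⟩

lemma IsSES.of_iso {X Y Z X' Y' Z' : A} (h : IsSES X Y Z) (e₁ : X ≅ X') (e₂ : Y ≅ Y')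
    (e₃ : Z ≅ Z') : IsSES X' Y' Z' := by
  obtain ⟨f, g, w, h⟩ := h
  refine ⟨e₁.inv ≫ f ≫ e₂.hom, e₂.inv ≫ g ≫ e₃.hom, by simp [reassoc_of% w], ?_⟩
  refine ShortComplex.shortExact_of_iso (ShortComplex.isoMk e₁ e₂ e₃ ?_ ?_) h <;> simp

lemma isSES_of_isZero_right {X Z : A} (hZ : IsZero Z) : IsSES X X Z :=
  ⟨𝟙 X, 0, by simp, (ShortComplex.Splitting.ofIsIsoOfIsZero (S := ShortComplex.mk (𝟙 X) (0 : X ⟶ Z)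
    (by simp)) (by dsimp; infer_instance) hZ).shortExact⟩

lemma isSES_of_isZero_left {X Z : A} (hZ : IsZero Z) : IsSES Z X X :=
  ⟨0, 𝟙 X, by simp, (ShortComplex.Splitting.ofIsZeroOfIsIso (S := ShortComplex.mk (0 : Z ⟶ X) (𝟙 X)
    (by simp)) hZ (by dsimp; infer_instance)).shortExact⟩

lemma isSES_biprod (X Z : A) : IsSES X (X ⊞ Z) Z :=
  ⟨biprod.inl, biprod.snd, by simp,
    (ShortComplex.Splitting.ofHasBinaryBiproduct X Z).shortExact⟩

lemma shortExact_biprod_map {X Y Z X' Y' Z' : A} {f : X ⟶ Y} {g : Y ⟶ Z} {w : f ≫ g = 0}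
    (h : (ShortComplex.mk f g w).ShortExact) {f' : X' ⟶ Y'} {g' : Y' ⟶ Z'} {w' : f' ≫ g' = 0}
    (h' : (ShortComplex.mk f' g' w').ShortExact) :
    (ShortComplex.mk (biprod.map f f') (biprod.map g g') (by ext <;> simp [w, w'])).ShortExact := by
  have := h.mono_f
  have := h.epi_g
  have := h'.mono_f
  have := h'.epi_g
  dsimp at *
  refine ShortComplex.ShortExact.mk' ?_ (by dsimp; infer_instance) (by dsimp; infer_instance)
  refine ShortComplex.exact_of_g_is_cokernel _
    (CokernelCofork.IsColimit.ofπ' _ _ fun {T} k hk => ?_)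
  dsimp at k hk
  have hk₁ : f ≫ biprod.inl ≫ k = 0 := by simpa using biprod.inl ≫= hk
  have hk₂ : f' ≫ biprod.inr ≫ k = 0 := by simpa using biprod.inr ≫= hk
  have e₁ := h.exact.g_desc (biprod.inl ≫ k) hk₁
  have e₂ := h'.exact.g_desc (biprod.inr ≫ k) hk₂
  dsimp at e₁ e₂
  refine ⟨biprod.desc (h.exact.desc (biprod.inl ≫ k) hk₁) (h'.exact.desc (biprod.inr ≫ k) hk₂), ?_⟩
  ext <;> simp [e₁, e₂]

lemma IsSES.biprod {X Y Z X' Y' Z' : A} (h : IsSES X Y Z) (h' : IsSES X' Y' Z') :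
    IsSES (X ⊞ X') (Y ⊞ Y') (Z ⊞ Z') := by
  obtain ⟨f, g, w, h⟩ := h
  obtain ⟨f', g', w', h'⟩ := h'
  exact ⟨_, _, _, shortExact_biprod_map h h'⟩

lemma IsSES.nonempty_iso_of_isZero_left {X Y Z : A} (h : IsSES X Y Z) (hX : IsZero X) :
    Nonempty (Y ≅ Z) := by
  obtain ⟨f, g, w, h⟩ := h
  have : IsIso g := h.isIso_g_iff.2 hX
  exact ⟨asIso g⟩

/-- Monomorphisms are stable under pushout in an abelian category, and parallel sides of a pushout
square have the same cokernel. -/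
lemma exists_shortExact_of_isPushout {X Y Z W D : A} {t : X ⟶ Y} {p : Y ⟶ D} {l : X ⟶ Z}
    {r : Y ⟶ W} {b : Z ⟶ W} (w : t ≫ p = 0) (h : (ShortComplex.mk t p w).ShortExact)
    (sq : IsPushout t l r b) :
    ∃ (q : W ⟶ D) (w' : b ≫ q = 0), r ≫ q = p ∧ (ShortComplex.mk b q w').ShortExact := by
  have : Mono t := h.mono_f
  have : Epi p := h.epi_g
  let q : W ⟶ D := sq.desc p 0 (by simp [w])
  have hr : r ≫ q = p := sq.inl_desc _ _ _
  have hb : b ≫ q = 0 := sq.inr_desc _ _ _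
  have : Mono b := by
    have := MorphismProperty.of_isPushout (P := .monomorphisms A) sq.flip
      (MorphismProperty.monomorphisms.infer_property t)
    exact this
  have : Epi (r ≫ q) := by rw [hr]; infer_instance
  have : Epi q := epi_of_epi r q
  refine ⟨q, hb, hr, ShortComplex.ShortExact.mk' ?_ ‹_› ‹_›⟩
  refine ShortComplex.exact_of_g_is_cokernel _ (CokernelCofork.IsColimit.ofπ' _ _ fun {T} k hk => ?_)
  dsimp at k hk
  have h1 : t ≫ r ≫ k = 0 := by rw [sq.w_assoc, hk, comp_zero]
  refine ⟨h.exact.desc (r ≫ k) h1, ?_⟩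
  refine sq.hom_ext ?_ ?_
  · have := h.exact.g_desc (r ≫ k) h1
    dsimp at this ⊢
    rw [← Category.assoc, hr, this]
  · dsimp
    rw [← Category.assoc, hb, zero_comp, hk]

/-- The pushout of a short exact sequence along a monomorphism. -/
lemma IsSES.pushout {X Y Z X' D : A} (h : IsSES X Y Z) (h' : IsSES X X' D) :
    ∃ E, IsSES X' E Z ∧ IsSES Y E D := by
  obtain ⟨f, g, w, h⟩ := h
  obtain ⟨f', g', w', h'⟩ := h'
  have sq := IsPushout.of_hasPushout f f'
  obtain ⟨q, wq, -, hq⟩ := exists_shortExact_of_isPushout w h sq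
  obtain ⟨q', wq', -, hq'⟩ := exists_shortExact_of_isPushout w' h' sq.flip
  exact ⟨_, ⟨_, _, _, hq⟩, ⟨_, _, _, hq'⟩⟩

/-- The quotients of a composition of monomorphisms. -/
lemma IsSES.trans {X Y Z E D : A} (h : IsSES X Y Z) (h' : IsSES Y E D) :
    ∃ L, IsSES X E L ∧ IsSES Z L D := by
  obtain ⟨f, g, w, h⟩ := h
  obtain ⟨f', g', w', h'⟩ := h'
  -- The quotient E/X is realised as the pushout of E and Z = Y/X under Y, which exhibits D as its
  -- quotient by Z.
  have sq := IsPushout.of_hasPushout f' g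
  obtain ⟨q, wq, -, hq⟩ := exists_shortExact_of_isPushout w' h' sq
  refine ⟨_, ⟨f ≫ f', pushout.inl f' g, ?_, ?_⟩, ⟨_, _, _, hq⟩⟩
  · rw [Category.assoc, sq.w, reassoc_of% w, zero_comp]
  · have : Mono f := h.mono_f
    have : Mono f' := h'.mono_f
    have : Epi g := h.epi_g
    refine ShortComplex.ShortExact.mk' ?_ (by dsimp; infer_instance) (by dsimp; infer_instance)
    refine ShortComplex.exact_of_g_is_cokernel _
      (CokernelCofork.IsColimit.ofπ' _ _ fun {T} k hk => ?_)
    dsimp at k hk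
    rw [Category.assoc] at hk
    refine ⟨sq.desc k (h.exact.desc (f' ≫ k) hk) ?_, sq.inl_desc _ _ _⟩
    exact (h.exact.g_desc (f' ≫ k) hk).symm

/-- The kernels of a composition of epimorphisms. -/
lemma IsSES.trans' {K Q Y X G : A} (h : IsSES K Q Y) (h' : IsSES X Y G) :
    ∃ W, IsSES K W X ∧ IsSES W Q G := by
  obtain ⟨L, h₁, h₂⟩ := (isSES_iff_op.1 h').trans (isSES_iff_op.1 h)
  exact ⟨L.unop, isSES_iff_op.2 h₂, isSES_iff_op.2 h₁⟩

/-! ### Vanishing of higher Ext and dimension shifting -/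

section Ext

open Abelian

variable [HasExt.{v} A]

/-- `Extⁿ(X, H) = 0` for all `n ≥ 1`. -/
def ExtOrtho (X H : A) : Prop := ∀ n : ℕ, Subsingleton (Ext X H (n + 1))

lemma extOrtho_iff {X H : A} : ExtOrtho X H ↔ ∀ (n : ℕ) (x : Ext X H (n + 1)), x = 0 :=
  ⟨fun h n _ => (h n).elim _ _, fun h n => ⟨fun x y => (h n x).trans (h n y).symm⟩⟩

lemma extOrtho_of_projective (X H : A) [Projective X] : ExtOrtho X H :=
  fun n => Ext.subsingleton_of_projective X H n

lemma ExtOrtho.of_retract_left {X Y H : A} (h : ExtOrtho Y H) (r : Retract X Y) :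
    ExtOrtho X H := by
  rw [extOrtho_iff] at h ⊢
  intro n x
  rw [← Ext.mk₀_id_comp x, ← r.retract, ← Ext.mk₀_comp_mk₀_assoc,
    h n ((Ext.mk₀ r.r).comp x (zero_add _)), Ext.comp_zero]

lemma ExtOrtho.of_iso_left {X Y H : A} (h : ExtOrtho Y H) (e : X ≅ Y) : ExtOrtho X H :=
  h.of_retract_left e.retract

lemma ExtOrtho.of_iso_right {X H H' : A} (h : ExtOrtho X H) (e : H ≅ H') : ExtOrtho X H' := by
  rw [extOrtho_iff] at h ⊢
  intro n x
  rw [← Ext.comp_mk₀_id x, ← e.inv_hom_id, ← Ext.mk₀_comp_mk₀,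
    ← Ext.comp_assoc_of_third_deg_zero, h n (x.comp (Ext.mk₀ e.inv) _), Ext.zero_comp]

lemma ExtOrtho.left₂ {X Y Z H : A} (h : IsSES X Y Z) (h₁ : ExtOrtho X H) (h₃ : ExtOrtho Z H) :
    ExtOrtho Y H := by
  obtain ⟨f, g, w, h⟩ := h
  rw [extOrtho_iff] at *
  intro n x
  obtain ⟨y, rfl⟩ := Ext.contravariant_sequence_exact₂ h H x (h₁ n _)
  rw [h₃ n y, Ext.comp_zero]

lemma ExtOrtho.left₁ {X Y Z H : A} (h : IsSES X Y Z) (h₂ : ExtOrtho Y H) (h₃ : ExtOrtho Z H) :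
    ExtOrtho X H := by
  obtain ⟨f, g, w, h⟩ := h
  rw [extOrtho_iff] at *
  intro n x
  obtain ⟨y, rfl⟩ := Ext.contravariant_sequence_exact₁ h H x (add_comm 1 (n + 1)) (h₃ _ _)
  rw [h₂ n y, Ext.comp_zero]

lemma ExtOrtho.right₂ {X Y Z T : A} (h : IsSES X Y Z) (h₁ : ExtOrtho T X) (h₃ : ExtOrtho T Z) :
    ExtOrtho T Y := by
  obtain ⟨f, g, w, h⟩ := h
  rw [extOrtho_iff] at *
  intro n x
  obtain ⟨y, rfl⟩ := Ext.covariant_sequence_exact₂ T h x (h₃ n _)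
  rw [h₁ n y, Ext.zero_comp]

lemma ExtOrtho.right₃ {X Y Z T : A} (h : IsSES X Y Z) (h₁ : ExtOrtho T X) (h₂ : ExtOrtho T Y) :
    ExtOrtho T Z := by
  obtain ⟨f, g, w, h⟩ := h
  rw [extOrtho_iff] at *
  intro n x
  obtain ⟨y, rfl⟩ := Ext.covariant_sequence_exact₃ T h x rfl (h₁ _ _)
  rw [h₂ n y, Ext.zero_comp]

/-- The obstruction to extending `k` along `f` lies in Ext¹(Z, H). -/
lemma ExtOrtho.exists_desc {X Y Z H : A} {f : X ⟶ Y} {g : Y ⟶ Z} {w : f ≫ g = 0}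
    (h : (ShortComplex.mk f g w).ShortExact) (hZ : ExtOrtho Z H) (k : X ⟶ H) :
    ∃ k' : Y ⟶ H, f ≫ k' = k := by
  obtain ⟨y, hy⟩ := Ext.contravariant_sequence_exact₁ h H (Ext.mk₀ k) (add_zero 1)
    ((hZ 0).elim _ _)
  obtain ⟨k', rfl⟩ := Ext.homEquiv₀.symm.surjective y
  refine ⟨k', (Ext.mk₀_bijective X H).1 ?_⟩
  rw [← hy, ← Ext.mk₀_comp_mk₀]
  rfl

/-- Since Ext¹(Y, H) = 0, the group Ext¹(Z, H) is the cokernel of Hom(Y, H) ⟶ Hom(X, H). -/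
lemma subsingleton_ext_one_of_exists_desc {X Y Z H : A} {f : X ⟶ Y} {g : Y ⟶ Z} {w : f ≫ g = 0}
    (h : (ShortComplex.mk f g w).ShortExact) (hY : ExtOrtho Y H)
    (hf : ∀ k : X ⟶ H, ∃ k' : Y ⟶ H, f ≫ k' = k) : Subsingleton (Ext Z H 1) := by
  suffices ∀ x : Ext Z H 1, x = 0 from ⟨fun x y => (this x).trans (this y).symm⟩
  intro x
  obtain ⟨y, rfl⟩ := Ext.contravariant_sequence_exact₃ h H x ((hY 0).elim _ _) (add_zero 1)
  obtain ⟨k, rfl⟩ := Ext.homEquiv₀.symm.surjective y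
  obtain ⟨k', rfl⟩ := hf k
  have : Ext.homEquiv₀.symm (f ≫ k') = (Ext.mk₀ f).comp (Ext.mk₀ k') (zero_add 0) := by
    rw [Ext.mk₀_comp_mk₀]; rfl
  rw [this]
  exact h.extClass_comp_assoc _

lemma subsingleton_ext_succ {X Y Z H : A} (h : IsSES X Y Z) (hY : ExtOrtho Y H) {n : ℕ}
    (hX : Subsingleton (Ext X H (n + 1))) : Subsingleton (Ext Z H (n + 2)) := by
  obtain ⟨f, g, w, h⟩ := h
  suffices ∀ x : Ext Z H (n + 2), x = 0 from ⟨fun x y => (this x).trans (this y).symm⟩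
  intro x
  obtain ⟨y, rfl⟩ := Ext.contravariant_sequence_exact₃ h H x ((hY (n + 1)).elim _ _)
    (add_comm 1 (n + 1))
  rw [hX.elim y 0, Ext.comp_zero]

lemma IsSES.nonempty_iso_biprod {X Y Z : A} (h : IsSES X Y Z) (hZ : ExtOrtho Z X) :
    Nonempty (Y ≅ X ⊞ Z) := by
  obtain ⟨f, g, w, h⟩ := h
  obtain ⟨r, hr⟩ := hZ.exists_desc h (𝟙 X)
  have := h.epi_g
  exact ⟨(ShortComplex.Splitting.ofExactOfRetraction _ h.exact r hr h.epi_g).isoBinaryBiproduct⟩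

end Ext

end Abelian

/-! ### Cycles and splicing -/

section Abelian

variable {A : Type u} [Category.{v} A] [Abelian A]

lemma shortExact_cycles {ι : Type*} {c : ComplexShape ι} (K : HomologicalComplex A c) {i j : ι}
    (hij : c.Rel i j) (hj : K.ExactAt j) :
    (ShortComplex.mk (K.iCycles i) (K.toCycles i j) (by simp [← cancel_mono (K.iCycles j)])
      ).ShortExact := by
  have : Epi (K.toCycles i j) := by
    obtain rfl := c.prev_eq' hij
    exact hj.epi_toCycles
  refine ShortComplex.ShortExact.mk' ?_ (by dsimp; infer_instance) this
  refine ShortComplex.exact_of_f_is_kernel _ (KernelFork.IsLimit.ofι' _ _ fun {T} k hk => ?_)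
  dsimp at k hk
  have hk' : k ≫ K.d i j = 0 := by
    rw [← K.toCycles_i i j, reassoc_of% hk, zero_comp]
  exact ⟨K.liftCycles k j (c.next_eq' hij) hk', by simp⟩

lemma exact_splice {W Z X Z' V : A} {f : Z ⟶ X} {g : X ⟶ Z'} {w : f ≫ g = 0}
    (h : (ShortComplex.mk f g w).ShortExact) (p : W ⟶ Z) [Epi p] (m : Z' ⟶ V) [Mono m]
    (w' : (p ≫ f) ≫ (g ≫ m) = 0) : (ShortComplex.mk (p ≫ f) (g ≫ m) w').Exact := by
  have h₁ : (ShortComplex.mk (p ≫ f) g (by rw [Category.assoc, w, comp_zero])).Exact :=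
    (ShortComplex.exact_iff_of_epi_of_isIso_of_mono
      (S₁ := ShortComplex.mk (p ≫ f) g (by rw [Category.assoc, w, comp_zero]))
      (S₂ := ShortComplex.mk f g w) { τ₁ := p, τ₂ := 𝟙 X, τ₃ := 𝟙 Z' }).2 h.exact
  exact (ShortComplex.exact_iff_of_epi_of_isIso_of_mono
      (S₁ := ShortComplex.mk (p ≫ f) g (by rw [Category.assoc, w, comp_zero]))
      (S₂ := ShortComplex.mk (p ≫ f) (g ≫ m) w') { τ₁ := 𝟙 W, τ₂ := 𝟙 X, τ₃ := m }).1 h₁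

/-! ### Resolutions of finite length -/

/-- There are short exact sequences breaking up an exact sequence
`0 ⟶ Gₙ ⟶ ⋯ ⟶ G₀ ⟶ X ⟶ 0` with all `Gᵢ` in `𝓧`. -/
def IsResolved (𝓧 : ObjectProperty A) : ℕ → ObjectProperty A
  | 0 => fun X => ∃ G, 𝓧 G ∧ Nonempty (G ≅ X)
  | n + 1 => fun X => ∃ G K, 𝓧 G ∧ IsSES K G X ∧ IsResolved 𝓧 n K

lemma IsResolved.of_iso {𝓧 : ObjectProperty A} {n : ℕ} {X Y : A} (h : IsResolved 𝓧 n X)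
    (e : X ≅ Y) : IsResolved 𝓧 n Y := by
  cases n with
  | zero =>
    obtain ⟨G, hG, ⟨e'⟩⟩ := h
    exact ⟨G, hG, ⟨e' ≪≫ e⟩⟩
  | succ n =>
    obtain ⟨G, K, hG, hK, h⟩ := h
    exact ⟨G, K, hG, hK.of_iso (Iso.refl _) (Iso.refl _) e, h⟩

lemma IsResolved.mono {𝓧 𝓨 : ObjectProperty A} (h𝓧 : ∀ X, 𝓧 X → 𝓨 X) {n : ℕ} {X : A}
    (h : IsResolved 𝓧 n X) : IsResolved 𝓨 n X := by
  induction n generalizing X with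
  | zero =>
    obtain ⟨G, hG, e⟩ := h
    exact ⟨G, h𝓧 _ hG, e⟩
  | succ n ih =>
    obtain ⟨G, K, hG, hK, h⟩ := h
    exact ⟨G, K, h𝓧 _ hG, hK, ih h⟩

lemma IsResolved.exists_sequence {𝓧 : ObjectProperty A} {n : ℕ} {X : A}
    (h : IsResolved 𝓧 n X) : ∃ K G : ℕ → A, K 0 = X ∧ (∀ i, IsSES (K (i + 1)) (G i) (K i)) ∧
      (∀ i, i ≤ n → 𝓧 (G i)) ∧ ∀ i, n < i → IsZero (G i) := by
  induction n generalizing X with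
  | zero =>
    obtain ⟨G, hG, ⟨e⟩⟩ := h
    refine ⟨fun i => Nat.casesOn i X fun _ => 0, fun i => Nat.casesOn i G fun _ => 0, rfl,
      ?_, ?_, ?_⟩
    · rintro (_ | i)
      · exact (isSES_of_isZero_left (isZero_zero A)).of_iso (Iso.refl _) (Iso.refl _) e
      · exact isSES_of_isZero_left (isZero_zero A)
    · rintro i hi
      obtain rfl : i = 0 := by lia
      exact hG
    · rintro (_ | i) hi
      · lia
      · exact isZero_zero A
  | succ n ih =>
    obtain ⟨G₀, K₀, hG₀, hS, h⟩ := h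
    obtain ⟨K, G, rfl, hK, hG, hG'⟩ := ih h
    refine ⟨fun i => Nat.casesOn i X K, fun i => Nat.casesOn i G₀ G, rfl, ?_, ?_, ?_⟩
    · rintro (_ | i)
      · exact hS
      · exact hK i
    · rintro (_ | i) hi
      · exact hG₀
      · exact hG i (by lia)
    · rintro (_ | i) hi
      · lia
      · exact hG' i (by lia)

/-- `Y 0` is the resolved object. Invertibility of `m 0` makes the last differential `p 0 ≫ m 0` an
epimorphism, which is exactness in degree 0. -/
lemma exists_acyclic_chainComplex_of_shortExact {Y K : ℕ → A} (m : ∀ i, K i ⟶ Y i)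
    (p : ∀ i, Y (i + 1) ⟶ K i) (w : ∀ i, m (i + 1) ≫ p i = 0)
    (hmp : ∀ i, (ShortComplex.mk (m (i + 1)) (p i) (w i)).ShortExact) (hm : IsIso (m 0)) :
    ∃ E : ChainComplex A ℕ, E.Acyclic ∧ E.X = Y := by
  have hm (i) : Mono (m i) := by
    cases i with
    | zero => infer_instance
    | succ i => exact (hmp i).mono_f
  have hp (i) : Epi (p i) := (hmp i).epi_g
  have hw (i) : (p (i + 1) ≫ m (i + 1)) ≫ p i ≫ m i = 0 := by
    rw [Category.assoc, reassoc_of% (w i), zero_comp, comp_zero]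
  let E : ChainComplex A ℕ := ChainComplex.of Y (fun i => p i ≫ m i) hw
  have hd (i) : E.d (i + 1) i = p i ≫ m i := ChainComplex.of_d Y (fun i => p i ≫ m i) i
  refine ⟨E, ?_, rfl⟩
  rintro (_ | i)
  · rw [E.exactAt_iff' 1 0 0 (by simp) (by simp), 
      ShortComplex.exact_iff_epi (E.sc' 1 0 0) (E.shape 0 0 (by simp))]
    change Epi (E.d 1 0)
    rw [show E.d 1 0 = p 0 ≫ m 0 from hd 0]
    exact epi_comp' (hp 0) inferInstance
  · rw [E.exactAt_iff' (i + 2) (i + 1) i (by simp) (by simp)]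
    have := exact_splice (hmp i) (p (i + 1)) (m i) (hw i)
    simp only [HomologicalComplex.sc', HomologicalComplex.shortComplexFunctor', hd]
    exact this

lemma hasResolutionOfLength_of_isResolved {𝓧 : ObjectProperty A} {n : ℕ} {X : A}
    (h : IsResolved 𝓧 n X) : HasResolutionOfLength 𝓧 X n := by
  obtain ⟨K, G, rfl, hS, hG, hG'⟩ := h.exists_sequence
  choose f g w hS using hS
  obtain ⟨E, hE, hX⟩ := exists_acyclic_chainComplex_of_shortExact
    (Y := fun i => Nat.casesOn i (K 0) G) (K := K) (fun i => Nat.casesOn i (𝟙 (K 0)) f) g w hS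
    (inferInstanceAs (IsIso (𝟙 (K 0))))
  have hX' (i : ℕ) : E.X (i + 1) = G i := congrFun hX (i + 1)
  exact ⟨E, hE, ⟨eqToIso (congrFun hX 0)⟩, fun i hi => hX' i ▸ hG i hi,
    fun i hi => hX' i ▸ hG' i hi⟩

lemma isResolved_of_hasResolutionOfLength {𝓧 : ObjectProperty A} {n : ℕ} {X : A}
    (h : HasResolutionOfLength 𝓧 X n) : IsResolved 𝓧 n X := by
  obtain ⟨E, hE, ⟨e⟩, hE₁, hE₂⟩ := h
  have hS (i : ℕ) : IsSES (E.cycles (i + 1)) (E.X (i + 1)) (E.cycles i) :=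
    ⟨_, _, _, shortExact_cycles E (i := i + 1) (j := i) (by simp) (hE i)⟩
  -- The cycles in degree `i` are resolved by the terms above, so they have length `n - i`; the
  -- recursion stops because the cycles in degree `n + 1` are a quotient of a zero object.
  have key : ∀ k i, i + k = n → IsResolved 𝓧 k (E.cycles i) := by
    intro k
    induction k with
    | zero =>
      rintro i rfl
      have : IsZero (E.cycles (i + 1)) := by
        have := (shortExact_cycles E (i := i + 2) (j := i + 1) (by simp) (hE _)).epi_g
        exact (hE₂ (i + 1) (by lia)).of_epi (E.toCycles (i + 2) (i + 1))
      exact ⟨_, hE₁ i (by lia), (hS i).nonempty_iso_of_isZero_left this⟩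
    | succ k ih => exact fun i hi => ⟨_, _, hE₁ i (by lia), hS i, ih _ (by lia)⟩
  have : IsIso (E.iCycles 0) := E.isIso_iCycles 0 0 (by simp) (by simp)
  exact (key n 0 (by lia)).of_iso (asIso (E.iCycles 0) ≪≫ e)

lemma hasResolutionOfLength_iff {𝓧 : ObjectProperty A} {n : ℕ} {X : A} :
    HasResolutionOfLength 𝓧 X n ↔ IsResolved 𝓧 n X :=
  ⟨isResolved_of_hasResolutionOfLength, hasResolutionOfLength_of_isResolved⟩

lemma resolutionDim_eq_iff {𝓧 : ObjectProperty A} {n : ℕ} {X : A} :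
    resolutionDim 𝓧 X = n ↔ IsResolved 𝓧 n X ∧ ∀ m, IsResolved 𝓧 m X → n ≤ m := by
  simp only [resolutionDim, hasResolutionOfLength_iff]
  constructor
  · intro h
    have hle : ∀ m, IsResolved 𝓧 m X → n ≤ m := fun m hm => by
      have : (n : ℕ∞) ≤ m := h ▸ iInf₂_le m hm
      exact_mod_cast this
    refine ⟨?_, hle⟩
    by_contra hn
    have : ((n + 1 : ℕ) : ℕ∞) ≤ n := by
      rw [← h]
      refine le_iInf₂ fun m hm => ?_
      have := hle m hm
      have : m ≠ n := by rintro rfl; exact hn hm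
      exact_mod_cast (by lia : n + 1 ≤ m)
    have : n + 1 ≤ n := by exact_mod_cast this
    lia
  · rintro ⟨h₁, h₂⟩
    exact le_antisymm (iInf₂_le n h₁) (le_iInf₂ fun m hm => by exact_mod_cast h₂ m hm)

end Abelian

/-- Glues iterated cosyzygies `R` and iterated syzygies `L` of one object; the last clause lets a
property be checked on each half separately. -/
lemma exists_int_sequence {α : Type*} {r s : α → α → Prop} {R L : ℕ → α} (h₀ : R 0 = L 0)
    (hR : ∀ n, r (R n) (R (n + 1))) (hL : ∀ n, s (L (n + 1)) (L n)) :
    ∃ K : ℤ → α, K 0 = R 0 ∧ (∀ i, 0 ≤ i → r (K i) (K (i + 1))) ∧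
      (∀ i, i < 0 → s (K i) (K (i + 1))) ∧ ∀ i, (∃ n, K i = R n) ∨ ∃ n, K i = L n := by
  refine ⟨fun | .ofNat n => R n | .negSucc n => L (n + 1), rfl, ?_, ?_, ?_⟩
  · rintro (n | n) hi
    · exact hR n
    · lia
  · rintro (n | _ | n) hi
    · exact absurd hi (by simp)
    · change s (L 1) (R 0)
      exact h₀ ▸ hL 0
    · exact hL (n + 1)
  · rintro (n | n)
    · exact .inl ⟨_, rfl⟩
    · exact .inr ⟨_, rfl⟩

section Abelian

variable {A : Type u} [Category.{v} A] [Abelian A]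

/-! ### Complete resolutions -/

/-- For Hom-exactness, a map killed by the incoming differential factors through the next `K`, and
the hypothesis on `H` extends this factor to the next `Y`. -/
lemma exists_cochainComplex_of_shortExact {Y K : ℤ → A} (m : ∀ i, K i ⟶ Y i)
    (p : ∀ i, Y i ⟶ K (i + 1)) (w : ∀ i, m i ≫ p i = 0)
    (hmp : ∀ i, (ShortComplex.mk (m i) (p i) (w i)).ShortExact) :
    ∃ E : CochainComplex A ℤ, E.Acyclic ∧ (∀ i, Nonempty (E.X i ≅ Y i)) ∧
      (∀ i j, i + 1 = j → Nonempty (K j ≅ image (E.d i j))) ∧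
      ∀ H : A, (∀ (i : ℤ) (h : K i ⟶ H), ∃ h' : Y i ⟶ H, m i ≫ h' = h) →
        ∀ i : ℤ, Function.Exact (fun h : E.X (i + 1) ⟶ H => E.d i (i + 1) ≫ h)
          (fun g : E.X i ⟶ H => E.d (i - 1) i ≫ g) := by
  have hm (i) : Mono (m i) := (hmp i).mono_f
  have hp (i) : Epi (p i) := (hmp i).epi_g
  have hw (i) : (p i ≫ m (i + 1)) ≫ p (i + 1) ≫ m (i + 1 + 1) = 0 := by
    rw [Category.assoc, reassoc_of% (w (i + 1)), zero_comp, comp_zero]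
  let E : CochainComplex A ℤ := CochainComplex.of Y (fun i => p i ≫ m (i + 1)) hw
  have hd (i) : E.d i (i + 1) = p i ≫ m (i + 1) :=
    CochainComplex.of_d Y (fun i => p i ≫ m (i + 1)) i
  refine ⟨E, ?_, fun i => ⟨Iso.refl _⟩, ?_, ?_⟩
  · intro j
    obtain ⟨i, rfl⟩ : ∃ i, j = i + 1 := ⟨j - 1, by lia⟩
    rw [E.exactAt_iff' i (i + 1) (i + 1 + 1) (by simp) (by simp)]
    have := exact_splice (hmp (i + 1)) (p i) (m (i + 1 + 1)) (hw i)
    simp only [HomologicalComplex.sc', HomologicalComplex.shortComplexFunctor', hd]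
    exact this
  · rintro i _ rfl
    have := strongEpi_of_epi (p i)
    exact ⟨image.isoStrongEpiMono (p i) (m (i + 1)) (hd i).symm⟩
  · intro H hH j
    suffices ∀ i, i + 1 = j → Function.Exact (fun h : E.X (j + 1) ⟶ H => E.d j (j + 1) ≫ h)
        (fun g : E.X j ⟶ H => E.d i j ≫ g) from this (j - 1) (by lia)
    rintro i rfl g
    simp only [hd]
    constructor
    · intro hg
      have hg' : m (i + 1) ≫ g = 0 := by
        rw [← cancel_epi (p i), comp_zero, ← Category.assoc]
        exact hg
      obtain ⟨h', hh'⟩ := hH _ ((hmp (i + 1)).exact.desc g hg')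
      refine ⟨h', ?_⟩
      have := (hmp (i + 1)).exact.g_desc g hg'
      rw [← hh'] at this
      exact (Category.assoc _ _ _).trans this
    · rintro ⟨h, rfl⟩
      exact (Category.assoc _ _ _).symm.trans ((congrArg (· ≫ h) (hw i)).trans zero_comp)

section Ext

open Abelian

variable [HasExt.{v} A]

/-- `𝓧` is a class of objects `Y` which are `Ext`-orthogonal to `𝓕` and which admit an embedding
into an object of `𝓠` with a cokernel in `𝓧`. -/
def IsCosyzygyClosed (𝓠 𝓕 𝓧 : ObjectProperty A) : Prop :=
  ∀ Y, 𝓧 Y → (∀ H, 𝓕 H → ExtOrtho Y H) ∧ ∃ Q Y', 𝓠 Q ∧ 𝓧 Y' ∧ IsSES Y Q Y'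

/-- The class consists of the cycles in nonnegative degrees. Hom-exactness extends maps into H from
cycles to terms, which kills Ext¹; dimension shifting along the whole complex kills the rest. -/
lemma isCosyzygyClosed_hasCompleteResolution {𝓟 𝓠 𝓕 : ObjectProperty A}
    (hP : ∀ P H, 𝓟 P → 𝓕 H → ExtOrtho P H) (hQ : ∀ Q H, 𝓠 Q → 𝓕 H → ExtOrtho Q H) {X : A}
    (hX : HasCompleteResolution 𝓟 𝓠 𝓕 X) :
    ∃ 𝓧 : ObjectProperty A, IsCosyzygyClosed 𝓠 𝓕 𝓧 ∧ 𝓧 X := by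
  obtain ⟨E, hE, hE𝓕, hE𝓟, hE𝓠, ⟨e⟩⟩ := hX
  have hS (i : ℤ) := shortExact_cycles E (i := i) (j := i + 1) (by simp) (hE _)
  have hEO (H : A) (hH : 𝓕 H) (i : ℤ) : ExtOrtho (E.X i) H := by
    by_cases hi : i < 0
    · exact hP _ _ (hE𝓟 i hi) hH
    · exact hQ _ _ (hE𝓠 i (by lia)) hH
  have hdesc (H : A) (hH : 𝓕 H) (i : ℤ) (k : E.cycles i ⟶ H) :
      ∃ k' : E.X i ⟶ H, E.iCycles i ≫ k' = k := by
    obtain ⟨j, rfl⟩ : ∃ j, i = j + 1 := ⟨i - 1, by lia⟩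
    have h₀ : E.d (j - 1) j ≫ E.toCycles j (j + 1) = 0 := by
      simp
    obtain ⟨k', hk'⟩ := (hE𝓕 H hH j (E.toCycles j (j + 1) ≫ k)).1
      (by dsimp only; rw [reassoc_of% h₀, zero_comp])
    have := (hS j).epi_g
    dsimp at this hk'
    refine ⟨k', ?_⟩
    rw [← cancel_epi (E.toCycles j (j + 1)), ← hk', E.toCycles_i_assoc]
  have hO (H : A) (hH : 𝓕 H) (n : ℕ) : ∀ i, Subsingleton (Ext (E.cycles i) H (n + 1)) := by
    induction n with
    | zero =>
      intro i
      obtain ⟨j, rfl⟩ : ∃ j, i = j + 1 := ⟨i - 1, by lia⟩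
      exact subsingleton_ext_one_of_exists_desc (hS j) (hEO H hH j) (hdesc H hH j)
    | succ n ih =>
      intro i
      obtain ⟨j, rfl⟩ : ∃ j, i = j + 1 := ⟨i - 1, by lia⟩
      exact subsingleton_ext_succ ⟨_, _, _, hS j⟩ (hEO H hH j) (ih j)
  have hE₀ : Epi (E.toCycles (-1) 0) :=
    (shortExact_cycles E (i := -1) (j := 0) (by simp) (hE _)).epi_g
  have hE₁ := strongEpi_of_epi (E.toCycles (-1) 0)
  have hE₂ : E.toCycles (-1) 0 ≫ E.iCycles 0 = E.d (-1) 0 := E.toCycles_i _ _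
  refine ⟨fun Y => ∃ i : ℤ, 0 ≤ i ∧ Nonempty (Y ≅ E.cycles i), ?_, 0, le_rfl,
    ⟨e ≪≫ (image.isoStrongEpiMono (E.toCycles (-1) 0) (E.iCycles 0) hE₂).symm⟩⟩
  rintro Y ⟨i, hi, ⟨e⟩⟩
  exact ⟨fun H hH => ExtOrtho.of_iso_left (fun n => hO H hH n i) e,
    _, _, hE𝓠 i hi, ⟨i + 1, by lia, ⟨Iso.refl _⟩⟩,
    IsSES.of_iso ⟨_, _, _, hS i⟩ e.symm (Iso.refl _) (Iso.refl _)⟩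

/-- Cosyzygies are iterated inside 𝓧 to the right and arbitrary 𝓟-syzygies are taken to the left.
Orthogonality to 𝓕 passes to syzygies, and it yields Hom-exactness of the spliced complex. -/
lemma IsCosyzygyClosed.hasCompleteResolution {𝓟 𝓠 𝓕 𝓧 : ObjectProperty A}
    [𝓟.IsClosedUnderIsomorphisms] [𝓠.IsClosedUnderIsomorphisms]
    (hP : ∀ P H, 𝓟 P → 𝓕 H → ExtOrtho P H)
    (hPX : ∀ X, ∃ P K, 𝓟 P ∧ IsSES K P X) (h𝓧 : IsCosyzygyClosed 𝓠 𝓕 𝓧) {X : A} (hX : 𝓧 X) :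
    HasCompleteResolution 𝓟 𝓠 𝓕 X := by
  choose P syz hPX' hsyz using hPX
  choose Q cosyz hQ' hcosyz hcS using fun Y : {Y // 𝓧 Y} => (h𝓧 Y.1 Y.2).2
  let next : {Y // 𝓧 Y} → {Y // 𝓧 Y} := fun Y => ⟨cosyz Y, hcosyz Y⟩
  obtain ⟨K, hK₀, hKR, hKL, hK⟩ := exists_int_sequence
    (r := fun Y Z => ∃ Q, 𝓠 Q ∧ IsSES Y Q Z) (s := fun Y Z => ∃ P, 𝓟 P ∧ IsSES Y P Z)
    (R := fun n => (next^[n] ⟨X, hX⟩).1) (L := fun n => syz^[n] X) rfl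
    (fun n => by
      simp only [Function.iterate_succ_apply']
      exact ⟨_, hQ' _, hcS _⟩)
    (fun n => by
      simp only [Function.iterate_succ_apply']
      exact ⟨_, hPX' _, hsyz _⟩)
  have hKO (H : A) (hH : 𝓕 H) (i : ℤ) : ExtOrtho (K i) H := by
    obtain ⟨n, hn⟩ | ⟨n, hn⟩ := hK i
    · rw [hn]
      exact (h𝓧 _ (next^[n] ⟨X, hX⟩).2).1 H hH
    · rw [hn]
      clear hn
      induction n with
      | zero => exact (h𝓧 X hX).1 H hH
      | succ n ih =>
        simp only [Function.iterate_succ_apply']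
        exact ExtOrtho.left₁ (hsyz _) (hP _ _ (hPX' _) hH) ih
  have hY (i : ℤ) : ∃ Y, IsSES (K i) Y (K (i + 1)) ∧ (i < 0 → 𝓟 Y) ∧ (0 ≤ i → 𝓠 Y) := by
    by_cases hi : i < 0
    · obtain ⟨Y, hY, hS⟩ := hKL i hi
      exact ⟨Y, hS, fun _ => hY, fun h => absurd h (by lia)⟩
    · obtain ⟨Y, hY, hS⟩ := hKR i (by lia)
      exact ⟨Y, hS, fun h => absurd h (by lia), fun _ => hY⟩
  choose Y hS hY𝓟 hY𝓠 using hY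
  choose m p w hmp using hS
  obtain ⟨E, hE, hEY, hEI, hEH⟩ := exists_cochainComplex_of_shortExact m p w hmp
  refine ⟨E, hE, fun H hH => hEH H fun i h => (hKO H hH _).exists_desc (hmp i) h,
    fun i hi => 𝓟.prop_of_iso (hEY i).some.symm (hY𝓟 i hi),
    fun i hi => 𝓠.prop_of_iso (hEY i).some.symm (hY𝓠 i hi), ?_⟩
  exact ⟨eqToIso (show X = K 0 from hK₀.symm) ≪≫ (hEI (-1) 0 rfl).some⟩

end Ext

end Abelian

section Abelian

variable {A : Type u} [Category.{v} A] [Abelian A]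

section Ext

open Abelian

variable [HasExt.{v} A]

/-! ### Approximations -/

/-- The hypotheses under which the class `𝓓` behaves like a class of relative Gorenstein
projective objects, with `𝓠` an injective cogenerator for `𝓓`. -/
structure IsRelativeGorenstein (𝓠 𝓓 : ObjectProperty A) : Prop where
  le : ∀ X, 𝓠 X → 𝓓 X
  iso : ∀ X Y, (X ≅ Y) → 𝓓 X → 𝓓 Y
  ext : ∀ X Y Z, IsSES X Y Z → 𝓓 X → 𝓓 Z → 𝓓 Y
  ker : ∀ X Y Z, IsSES X Y Z → 𝓓 Y → 𝓓 Z → 𝓓 X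
  ortho : ∀ X Q, 𝓓 X → 𝓠 Q → ExtOrtho X Q
  cosyzygy : ∀ X, 𝓓 X → ∃ Q Y, 𝓠 Q ∧ 𝓓 Y ∧ IsSES X Q Y

lemma isRelativeGorenstein_hasCompleteResolution {𝓟 𝓠 𝓕 : ObjectProperty A}
    [𝓟.IsClosedUnderIsomorphisms] [𝓠.IsClosedUnderIsomorphisms]
    (hP : ∀ P H, 𝓟 P → 𝓕 H → ExtOrtho P H) (hQ : ∀ Q H, 𝓠 Q → 𝓕 H → ExtOrtho Q H)
    (hPX : ∀ X, ∃ P K, 𝓟 P ∧ IsSES K P X) (h𝓠𝓕 : ∀ Q, 𝓠 Q → 𝓕 Q) (h𝓠₀ : 𝓠 0)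
    (h𝓠 : ∀ Q Q', 𝓠 Q → 𝓠 Q' → 𝓠 (Q ⊞ Q')) :
    IsRelativeGorenstein 𝓠 (HasCompleteResolution 𝓟 𝓠 𝓕) := by
  have hunfold {X : A} (hX : HasCompleteResolution 𝓟 𝓠 𝓕 X) :
      (∀ H, 𝓕 H → ExtOrtho X H) ∧
        ∃ Q Y, 𝓠 Q ∧ HasCompleteResolution 𝓟 𝓠 𝓕 Y ∧ IsSES X Q Y := by
    obtain ⟨𝓧, h𝓧, hX⟩ := isCosyzygyClosed_hasCompleteResolution hP hQ hX
    obtain ⟨h, Q, Y, hQ', hY, hS⟩ := h𝓧 X hX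
    exact ⟨h, Q, Y, hQ', h𝓧.hasCompleteResolution hP hPX hY, hS⟩
  have hfold {𝓧 : ObjectProperty A} (h𝓧 : IsCosyzygyClosed 𝓠 𝓕 𝓧) {X : A} (hX : 𝓧 X) :=
    h𝓧.hasCompleteResolution hP hPX hX
  have hext : ∀ X Y Z, IsSES X Y Z → HasCompleteResolution 𝓟 𝓠 𝓕 X →
      HasCompleteResolution 𝓟 𝓠 𝓕 Z → HasCompleteResolution 𝓟 𝓠 𝓕 Y := by
    refine fun X Y Z hS hX hZ => hfold (𝓧 := fun Y => ∃ X Z, HasCompleteResolution 𝓟 𝓠 𝓕 X ∧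
      HasCompleteResolution 𝓟 𝓠 𝓕 Z ∧ IsSES X Y Z) ?_ ⟨X, Z, hX, hZ, hS⟩
    rintro Y ⟨X, Z, hX, hZ, hS⟩
    obtain ⟨hXO, QX, X', hQX, hX', hSX⟩ := hunfold hX
    obtain ⟨hZO, QZ, Z', hQZ, hZ', hSZ⟩ := hunfold hZ
    -- A horseshoe: the pushout E of Y along X ⟶ QX splits as QX ⊞ Z, hence embeds into QX ⊞ QZ with
    -- cokernel Z'. The cokernel of Y in QX ⊞ QZ is then an extension of Z' by X'.
    obtain ⟨E, hE₁, hE₂⟩ := hS.pushout hSX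
    obtain ⟨e⟩ := hE₁.nonempty_iso_biprod (hZO _ (h𝓠𝓕 _ hQX))
    have hQE : IsSES E (QX ⊞ QZ) ((0 : A) ⊞ Z') :=
      ((isSES_of_isZero_right (isZero_zero A)).biprod hSZ).of_iso e.symm (Iso.refl _) (Iso.refl _)
    obtain ⟨e₀⟩ := (isSES_biprod (0 : A) Z').nonempty_iso_of_isZero_left (isZero_zero A)
    obtain ⟨L, hL₁, hL₂⟩ := hE₂.trans (hQE.of_iso (Iso.refl _) (Iso.refl _) e₀)
    exact ⟨fun H hH => ExtOrtho.left₂ hS (hXO H hH) (hZO H hH), _, L, h𝓠 _ _ hQX hQZ,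
      ⟨X', Z', hX', hZ', hL₂⟩, hL₁⟩
  refine ⟨fun X hX => hfold (𝓧 := 𝓠) ?_ hX, ?_, hext, ?_, ?_, fun X hX => (hunfold hX).2⟩
  · exact fun Y hY => ⟨fun H hH => hQ Y H hY hH, Y, 0, hY, h𝓠₀,
      isSES_of_isZero_right (isZero_zero A)⟩
  · rintro X Y e ⟨E, h₁, h₂, h₃, h₄, ⟨e'⟩⟩
    exact ⟨E, h₁, h₂, h₃, h₄, ⟨e.symm ≪≫ e'⟩⟩
  · intro X Y Z hS hY hZ
    -- Only the first cosyzygy of X needs constructing: for Y ⊆ Q, the quotient Q/X is an extension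
    -- of Q/Y by Z, so it already has a complete resolution.
    refine hfold (𝓧 := fun W => W = X ∨ HasCompleteResolution 𝓟 𝓠 𝓕 W) ?_ (.inl rfl)
    rintro W (rfl | hW)
    · obtain ⟨hYO, Q, Y', hQ', hY', hSY⟩ := hunfold hY
      obtain ⟨L, hL₁, hL₂⟩ := hS.trans hSY
      exact ⟨fun H hH => ExtOrtho.left₁ hS (hYO H hH) ((hunfold hZ).1 H hH), Q, L, hQ',
        .inr (hext _ _ _ hL₂ hZ hY'), hL₁⟩
    · obtain ⟨hO, Q, Y', hQ', hY', hSY⟩ := hunfold hW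
      exact ⟨hO, Q, Y', hQ', .inr hY', hSY⟩
  · exact fun X Q hX hQ' => (hunfold hX).1 Q (h𝓠𝓕 Q hQ')

namespace IsRelativeGorenstein

variable {𝓠 𝓓 : ObjectProperty A} (h : IsRelativeGorenstein 𝓠 𝓓)
include h

lemma ortho_of_isResolved {n : ℕ} {X K : A} (hX : 𝓓 X) (hK : IsResolved 𝓠 n K) :
    ExtOrtho X K := by
  induction n generalizing K with
  | zero =>
    obtain ⟨Q, hQ, ⟨e⟩⟩ := hK
    exact (h.ortho X Q hX hQ).of_iso_right e
  | succ n ih =>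
    obtain ⟨Q, L, hQ, hS, hL⟩ := hK
    exact ExtOrtho.right₃ hS (ih hL) (h.ortho X Q hX hQ)

/-- From a hull one obtains a precover and vice versa. -/
lemma exists_hull_of_precover {n : ℕ} {X G K : A} (hS : IsSES K G X) (hG : 𝓓 G)
    (hK : IsResolved 𝓠 n K) : ∃ Y G', IsSES X Y G' ∧ 𝓓 G' ∧ IsResolved 𝓠 (n + 1) Y := by
  obtain ⟨Q, G', hQ, hG', hS'⟩ := h.cosyzygy G hG
  obtain ⟨Y, hY, hY'⟩ := hS.trans hS'
  exact ⟨Y, G', hY', hG', Q, K, hQ, hY, hK⟩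

/-- A hull X₁ ⟶ Y₁ of the first syzygy, pushed out along X₁ ⟶ G₀, gives an extension Z of G₁ by G₀.
It lies in 𝓓 and maps onto X with kernel Y₁: a precover. Embedding Z into an object of 𝓠 and
dividing by Y₁ turns it into a hull. -/
lemma exists_hull_and_precover {n : ℕ} {X : A} (hX : IsResolved 𝓓 n X) :
    (∃ Y G, IsSES X Y G ∧ 𝓓 G ∧ IsResolved 𝓠 n Y) ∧
      ∀ m, n = m + 1 → ∃ K G, IsSES K G X ∧ 𝓓 G ∧ IsResolved 𝓠 m K := by
  induction n generalizing X with
  | zero =>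
    obtain ⟨G, hG, ⟨e⟩⟩ := hX
    obtain ⟨Q, G', hQ, hG', hS⟩ := h.cosyzygy X (h.iso _ _ e hG)
    exact ⟨⟨Q, G', hS, hG', Q, hQ, ⟨Iso.refl Q⟩⟩, fun m hm => by lia⟩
  | succ n ih =>
    obtain ⟨G₀, X₁, hG₀, hS, hX₁⟩ := hX
    obtain ⟨Y₁, G₁, hS₁, hG₁, hY₁⟩ := (ih hX₁).1
    obtain ⟨Z, hZ, hZ'⟩ := hS.pushout hS₁
    have hZ𝓓 : 𝓓 Z := h.ext _ _ _ hZ' hG₀ hG₁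
    refine ⟨h.exists_hull_of_precover hZ hZ𝓓 hY₁, fun m hm => ?_⟩
    obtain rfl : n = m := by lia
    exact ⟨Y₁, Z, hZ, hZ𝓓, hY₁⟩

/-- Ensures that the hull has no shorter resolution than X. The kernel W of Q ⟶ Y ⟶ G lies in 𝓓 and
maps onto X with the same kernel K as Q ⟶ Y. -/
lemma isResolved_of_hull {n : ℕ} {X Y G : A} (hS : IsSES X Y G) (hG : 𝓓 G)
    (hY : IsResolved 𝓠 n Y) : IsResolved 𝓓 n X := by
  cases n with
  | zero =>
    obtain ⟨Q, hQ, ⟨e⟩⟩ := hY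
    exact ⟨X, h.ker _ _ _ hS (h.iso _ _ e (h.le _ hQ)) hG, ⟨Iso.refl X⟩⟩
  | succ n =>
    obtain ⟨Q, K, hQ, hS', hK⟩ := hY
    obtain ⟨W, hW, hW'⟩ := hS'.trans' hS
    exact ⟨W, K, h.ker _ _ _ hW' (h.le _ hQ) hG, hW, hK.mono h.le⟩

lemma exists_hull_of_resolutionDim_eq {n : ℕ} {X : A} (hX : resolutionDim 𝓓 X = n) :
    ∃ (Y G : A) (i : X ⟶ Y) (p : Y ⟶ G) (w : i ≫ p = 0), (ShortComplex.mk i p w).ShortExact ∧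
      𝓓 G ∧ resolutionDim 𝓠 Y = n := by
  rw [resolutionDim_eq_iff] at hX
  obtain ⟨Y, G, hS, hG, hY⟩ := (h.exists_hull_and_precover hX.1).1
  have hY' : resolutionDim 𝓠 Y = n :=
    resolutionDim_eq_iff.2 ⟨hY, fun m hm => hX.2 m (h.isResolved_of_hull hS hG hm)⟩
  obtain ⟨i, p, w, hS⟩ := hS
  exact ⟨Y, G, i, p, w, hS, hG, hY'⟩

lemma exists_isSpecialPrecover_of_resolutionDim_eq {n : ℕ} {X : A}
    (hX : resolutionDim 𝓓 X = n) :
    ∃ (K G : A) (i : K ⟶ G) (p : G ⟶ X), IsSpecialPrecover 𝓓 i p ∧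
      (0 < n → resolutionDim 𝓠 K = ((n - 1 : ℕ) : ℕ∞)) ∧ (n = 0 → IsZero K) := by
  rw [resolutionDim_eq_iff] at hX
  obtain ⟨hX, hmin⟩ := hX
  cases n with
  | zero =>
    obtain ⟨G, hG, ⟨e⟩⟩ := hX
    obtain ⟨i, p, w, hS⟩ := isSES_of_isZero_left (X := X) (isZero_zero A)
    refine ⟨0, X, i, p, ⟨w, hS, h.iso _ _ e hG, fun F _ => ⟨fun x y => ?_⟩⟩,
      fun hn => absurd hn (by lia), fun _ => isZero_zero A⟩
    rw [← Ext.comp_mk₀_id x, ← Ext.comp_mk₀_id y, (isZero_zero A).eq_of_src (𝟙 (0 : A)) 0,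
      Ext.mk₀_zero, Ext.comp_zero, Ext.comp_zero]
  | succ n =>
    obtain ⟨K, G, hS, hG, hK⟩ := (h.exists_hull_and_precover hX).2 n rfl
    have hK' : resolutionDim 𝓠 K = n := resolutionDim_eq_iff.2 ⟨hK, fun m hm => by
      have := hmin (m + 1) ⟨G, K, hG, hS, hm.mono h.le⟩
      lia⟩
    obtain ⟨i, p, w, hS⟩ := hS
    exact ⟨K, G, i, p, ⟨w, hS, hG, fun F hF => h.ortho_of_isResolved hF hK 0⟩, fun _ => hK',
      fun hn => absurd hn (by lia)⟩

end IsRelativeGorenstein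

end Ext

end Abelian

section Modules

variable {R : Type u} [CommRing R]

/-! ### Ext between tensor products of modules -/

lemma extOrtho_iff_of_projectiveResolution {A : Type u} [Category.{v} A] [Abelian A]
    [HasExt.{v} A] {X : A} (P : ProjectiveResolution X) (Y : A) :
    ExtOrtho X Y ↔ ∀ (n : ℕ) (f : P.complex.X (n + 1) ⟶ Y),
      P.complex.d (n + 2) (n + 1) ≫ f = 0 → ∃ g, P.complex.d (n + 1) n ≫ g = f := by
  rw [extOrtho_iff]
  refine forall_congr' fun n => ⟨fun h f hf => ?_, fun h x => ?_⟩
  · exact (P.extMk_eq_zero_iff f (n + 2) rfl hf n rfl).1 (h _)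
  · obtain ⟨f, hf, rfl⟩ := P.extMk_surjective x (n + 2) rfl
    exact (P.extMk_eq_zero_iff f (n + 2) rfl hf n rfl).2 (h f hf)

lemma rTensorHomEquivHomRTensor_lcomp {M M' N F : Type u} [AddCommGroup M] [Module R M]
    [AddCommGroup M'] [Module R M'] [AddCommGroup N] [Module R N] [AddCommGroup F] [Module R F]
    [Module.Projective R M] [Module.Finite R M] [Module.Projective R M'] [Module.Finite R M']
    (d : M' →ₗ[R] M) (x : (M →ₗ[R] N) ⊗[R] F) :
    rTensorHomEquivHomRTensor R M' N F ((d.lcomp R N).rTensor F x) =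
      rTensorHomEquivHomRTensor R M N F x ∘ₗ d := by
  induction x with
  | zero => simp
  | add x y hx hy => rw [map_add, map_add, hx, hy, map_add, LinearMap.add_comp]
  | tmul f y => ext m; simp

/-- For finitely generated projective Pₙ, Hom(Pₙ, N) ⊗ F ≅ Hom(Pₙ, N ⊗ F) naturally, and tensoring
with the flat F preserves exactness of Hom(P, N) in positive degrees. -/
lemma extOrtho_tensor_flat {M N : ModuleCat.{u} R} (P : ProjectiveResolution M)
    (hP : ∀ n, Module.Finite R (P.complex.X n)) (hMN : ExtOrtho M N) (F : Type u)
    [AddCommGroup F] [Module R F] [Module.Flat R F] :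
    ExtOrtho M (ModuleCat.of R (N ⊗[R] F)) := by
  rw [extOrtho_iff_of_projectiveResolution P] at hMN ⊢
  intro n f hf
  have hproj (n) : Module.Projective R (P.complex.X n) :=
    (IsProjective.iff_projective _).2 (P.projective n)
  have hex : Function.Exact ((P.complex.d (n + 1) n).hom.lcomp R N)
      ((P.complex.d (n + 2) (n + 1)).hom.lcomp R N) := by
    intro k
    constructor
    · intro hk
      obtain ⟨g, hg⟩ := hMN n (ModuleCat.ofHom k) (ModuleCat.hom_ext hk)
      exact ⟨g.hom, congrArg ModuleCat.Hom.hom hg⟩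
    · rintro ⟨g, rfl⟩
      have := congrArg ModuleCat.Hom.hom (P.complex.d_comp_d (n + 2) (n + 1) n)
      ext x
      have := LinearMap.congr_fun this x
      exact (congrArg g this).trans (map_zero g)
  let e (n : ℕ) := rTensorHomEquivHomRTensor R (P.complex.X n) N F
  obtain ⟨y, hy⟩ := (Module.Flat.rTensor_exact F hex ((e (n + 1)).symm f.hom)).1 (by
    apply (e (n + 2)).injective
    rw [map_zero, rTensorHomEquivHomRTensor_lcomp, LinearEquiv.apply_symm_apply]
    exact congrArg ModuleCat.Hom.hom hf)
  refine ⟨ModuleCat.ofHom (e n y), ?_⟩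
  ext1
  have := rTensorHomEquivHomRTensor_lcomp (P.complex.d (n + 1) n).hom y
  rw [hy, LinearEquiv.apply_symm_apply] at this
  exact this.symm

lemma shortExact_rTensor {S : ShortComplex (ModuleCat.{u} R)} (hS : S.ShortExact) (P : Type u)
    [AddCommGroup P] [Module R P] [Module.Flat R P] :
    (ShortComplex.mk (ModuleCat.ofHom (S.f.hom.rTensor P)) (ModuleCat.ofHom (S.g.hom.rTensor P))
      (by rw [← ModuleCat.ofHom_comp, ← LinearMap.rTensor_comp, ← ModuleCat.hom_comp, S.zero]
          simp)).ShortExact := by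
  refine ModuleCat.shortComplex_shortExact _ ?_ ?_ ?_
  · exact Module.Flat.rTensor_exact P
      ((ShortComplex.ShortExact.moduleCat_exact_iff_function_exact S).1 hS.exact)
  · exact Module.Flat.rTensor_preserves_injective_linearMap _ hS.moduleCat_injective_f
  · exact LinearMap.rTensor_surjective P hS.moduleCat_surjective_g

lemma exists_shortExact_projective (M : ModuleCat.{u} R) :
    ∃ S : ShortComplex (ModuleCat.{u} R), S.ShortExact ∧ Module.Projective R S.X₂ ∧ S.X₃ = M :=
  ⟨ShortComplex.mk (kernel.ι (Projective.π M)) (Projective.π M) (kernel.condition _),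
    ShortComplex.ShortExact.mk' (ShortComplex.kernelSequence_exact _) inferInstance inferInstance,
    (IsProjective.iff_projective _).2 (Projective.projective_over M), rfl⟩

/-- By adjunction a map X₁ ⊗ P ⟶ N is a map P ⟶ Hom(X₁, N). It lifts along the surjection Hom(X₂, N)
⟶ Hom(X₁, N) because P is projective. Higher degrees follow by dimension shifting. -/
lemma extOrtho_tensor_projective {M N : ModuleCat.{u} R} (hMN : ExtOrtho M N) (P : Type u)
    [AddCommGroup P] [Module R P] [Module.Projective R P] :
    ExtOrtho (ModuleCat.of R (M ⊗[R] P)) N := by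
  intro n
  induction n generalizing M with
  | zero =>
    obtain ⟨S, hS, hS₂, rfl⟩ := exists_shortExact_projective M
    refine subsingleton_ext_one_of_exists_desc (shortExact_rTensor hS P)
      (have : Projective (ModuleCat.of R (S.X₂ ⊗[R] P)) :=
        (IsProjective.iff_projective _).1 inferInstance
       extOrtho_of_projective _ _) fun k => ?_
    have hsurj : Function.Surjective (S.f.hom.lcomp R N) := fun f => by
      obtain ⟨g, hg⟩ := hMN.exists_desc hS (ModuleCat.ofHom f)
      exact ⟨g.hom, congrArg ModuleCat.Hom.hom hg⟩
    obtain ⟨l, hl⟩ := Module.projective_lifting_property (S.f.hom.lcomp R N)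
      (TensorProduct.curry k.hom).flip hsurj
    refine ⟨ModuleCat.ofHom (TensorProduct.lift l.flip), ?_⟩
    ext1
    refine TensorProduct.ext' fun x y => ?_
    have := LinearMap.congr_fun (LinearMap.congr_fun hl y) x
    simpa using this
  | succ n ih =>
    obtain ⟨S, hS, hS₂, rfl⟩ := exists_shortExact_projective M
    refine subsingleton_ext_succ ⟨_, _, _, shortExact_rTensor hS P⟩
      (have : Projective (ModuleCat.of R (S.X₂ ⊗[R] P)) :=
        (IsProjective.iff_projective _).1 inferInstance
       extOrtho_of_projective _ _) (ih (M := S.X₁) ?_)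
    exact ExtOrtho.left₁ ⟨_, _, _, hS⟩
      (have := (IsProjective.iff_projective _).1 hS₂; extOrtho_of_projective S.X₂ N) hMN

lemma IsSemidualizing.extOrtho {C : ModuleCat.{u} R} (hC : IsSemidualizing C)
    {M N : ModuleCat.{u} R} (hM : cProjMod C M) (hN : cFlatMod C N) : ExtOrtho M N := by
  obtain ⟨P, hP, ⟨e⟩⟩ := hM
  obtain ⟨F, hF, ⟨e'⟩⟩ := hN
  obtain ⟨Q, hQ⟩ := hC.exists_resolution
  have h₁ : ExtOrtho C C := fun n => hC.ext_self (n + 1) (by lia)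
  have h₂ := extOrtho_tensor_projective (extOrtho_tensor_flat Q hQ h₁ F) P
  exact (h₂.of_iso_left e.toModuleIso).of_iso_right e'.symm.toModuleIso

lemma cProjMod_le_cFlatMod (C : ModuleCat.{u} R) {M : ModuleCat.{u} R} (hM : cProjMod C M) :
    cFlatMod C M := by
  obtain ⟨P, hP, e⟩ := hM
  exact ⟨P, inferInstance, e⟩

end Modules

section Disc

variable {B : Type u} [Category.{v} B] [Abelian B]

/-! ### Disc complexes -/

/-- The direct sum over all `n` of the complexes `M n ⟶ M n` concentrated in degrees `n` and
`n - 1`. -/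
noncomputable def disc (M : ℤ → B) : ChainComplex B ℤ :=
  ChainComplex.of (fun n => M n ⊞ M (n + 1)) (fun _ => biprod.fst ≫ biprod.inr)
    (fun n => by simp)

/-- The decomposition of the degree `n` part of `disc M`. -/
noncomputable def discXIso (M : ℤ → B) (n : ℤ) : (disc M).X n ≅ M n ⊞ M (n + 1) := Iso.refl _

/-- The inclusion of the summand `M n` of `disc M` in degree `n`. -/
noncomputable def discInl (M : ℤ → B) (n : ℤ) : M n ⟶ (disc M).X n :=
  biprod.inl ≫ (discXIso M n).inv

/-- The inclusion of the summand `M (n + 1)` of `disc M` in degree `n`. -/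
noncomputable def discInr (M : ℤ → B) (n : ℤ) : M (n + 1) ⟶ (disc M).X n :=
  biprod.inr ≫ (discXIso M n).inv

/-- The projection to the summand `M n` of `disc M` in degree `n`. -/
noncomputable def discFst (M : ℤ → B) (n : ℤ) : (disc M).X n ⟶ M n :=
  (discXIso M n).hom ≫ biprod.fst

/-- The projection to the summand `M (n + 1)` of `disc M` in degree `n`. -/
noncomputable def discSnd (M : ℤ → B) (n : ℤ) : (disc M).X n ⟶ M (n + 1) :=
  (discXIso M n).hom ≫ biprod.snd

@[simp]
lemma discInl_discFst (M : ℤ → B) (n : ℤ) : discInl M n ≫ discFst M n = 𝟙 _ := by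
  simp [discInl, discFst]

@[simp]
lemma discInl_discFst_assoc (M : ℤ → B) (n : ℤ) {T : B}
    (h : M n ⟶ T) : discInl M n ≫ discFst M n ≫ h = h := by
  rw [← Category.assoc, discInl_discFst]
  simp

@[simp]
lemma discInl_discSnd (M : ℤ → B) (n : ℤ) : discInl M n ≫ discSnd M n = 0 := by
  simp [discInl, discSnd]

@[simp]
lemma discInl_discSnd_assoc (M : ℤ → B) (n : ℤ) {T : B}
    (h : M (n + 1) ⟶ T) : discInl M n ≫ discSnd M n ≫ h = 0 := by
  rw [← Category.assoc, discInl_discSnd]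
  simp

@[simp]
lemma discInr_discFst (M : ℤ → B) (n : ℤ) : discInr M n ≫ discFst M n = 0 := by
  simp [discInr, discFst]

@[simp]
lemma discInr_discFst_assoc (M : ℤ → B) (n : ℤ) {T : B}
    (h : M n ⟶ T) : discInr M n ≫ discFst M n ≫ h = 0 := by
  rw [← Category.assoc, discInr_discFst]
  simp

@[simp]
lemma discInr_discSnd (M : ℤ → B) (n : ℤ) : discInr M n ≫ discSnd M n = 𝟙 _ := by
  simp [discInr, discSnd]

@[simp]
lemma discInr_discSnd_assoc (M : ℤ → B) (n : ℤ) {T : B}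
    (h : M (n + 1) ⟶ T) : discInr M n ≫ discSnd M n ≫ h = h := by
  rw [← Category.assoc, discInr_discSnd]
  simp

lemma disc_total (M : ℤ → B) (n : ℤ) :
    discFst M n ≫ discInl M n + discSnd M n ≫ discInr M n = 𝟙 _ := by
  simp only [discFst, discInl, discSnd, discInr, Category.assoc]
  rw [← Preadditive.comp_add, ← Category.assoc biprod.fst, ← Category.assoc biprod.snd,
    ← Preadditive.add_comp, biprod.total, Category.id_comp, Iso.hom_inv_id]

@[simp]
lemma disc_d (M : ℤ → B) (n : ℤ) :
    (disc M).d (n + 1) n = discFst M (n + 1) ≫ discInr M n := by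
  have h : (disc M).d (n + 1) n = (discXIso M (n + 1)).hom ≫ (biprod.fst ≫ biprod.inr) ≫
      (discXIso M n).inv :=
    (ChainComplex.of_d (fun n => M n ⊞ M (n + 1)) (fun _ => biprod.fst ≫ biprod.inr) n).trans
      ((Category.comp_id _).symm.trans (Category.id_comp _).symm)
  simp [h, discFst, discInr]

lemma discX_hom_ext {M : ℤ → B} {n : ℤ} {T : B} {f g : (disc M).X n ⟶ T}
    (h₁ : discInl M n ≫ f = discInl M n ≫ g) (h₂ : discInr M n ≫ f = discInr M n ≫ g) :
    f = g := by
  rw [← Category.id_comp f, ← Category.id_comp g, ← disc_total M n]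
  simp [h₁, h₂]

/-- The other summand is reached from `M (n + 1)` by the differential. With `discDesc`, this makes
`disc` left adjoint to forgetting differentials. -/
lemma disc_hom_ext {M : ℤ → B} {Y : ChainComplex B ℤ} {f g : disc M ⟶ Y}
    (h : ∀ n, discInl M n ≫ f.f n = discInl M n ≫ g.f n) : f = g := by
  ext n
  have hr : discInr M n = discInl M (n + 1) ≫ (disc M).d (n + 1) n := by simp
  refine discX_hom_ext (h n) ?_
  rw [hr, Category.assoc, Category.assoc, ← f.comm, ← g.comm, reassoc_of% (h (n + 1))]

/-- The morphism from `disc M` given by a family of morphisms in each degree. -/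
noncomputable def discDesc {M : ℤ → B} {Y : ChainComplex B ℤ} (φ : ∀ n, M n ⟶ Y.X n) :
    disc M ⟶ Y where
  f n := discFst M n ≫ φ n + discSnd M n ≫ φ (n + 1) ≫ Y.d (n + 1) n
  comm' := by
    rintro _ n rfl
    simp

@[simp]
lemma discInl_discDesc {M : ℤ → B} {Y : ChainComplex B ℤ} (φ : ∀ n, M n ⟶ Y.X n) (n : ℤ) :
    discInl M n ≫ (discDesc φ).f n = φ n := by
  simp [discDesc]

@[simp]
lemma discInl_discDesc_assoc {M : ℤ → B} {Y : ChainComplex B ℤ} (φ : ∀ n, M n ⟶ Y.X n)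
    (n : ℤ) {T : B} (h : Y.X n ⟶ T) : discInl M n ≫ (discDesc φ).f n ≫ h = φ n ≫ h := by
  rw [← Category.assoc, discInl_discDesc]

lemma discDesc_comp {M : ℤ → B} {Y Z : ChainComplex B ℤ} (φ : ∀ n, M n ⟶ Y.X n) (g : Y ⟶ Z) :
    discDesc φ ≫ g = discDesc fun n => φ n ≫ g.f n :=
  disc_hom_ext fun n => by simp

/-- The functoriality of `disc`. -/
noncomputable def discMap {M N : ℤ → B} (φ : ∀ n, M n ⟶ N n) : disc M ⟶ disc N :=
  discDesc fun n => φ n ≫ discInl N n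

lemma discMap_f {M N : ℤ → B} (φ : ∀ n, M n ⟶ N n) (n : ℤ) :
    (discMap φ).f n = (discXIso M n).hom ≫ biprod.map (φ n) (φ (n + 1)) ≫ (discXIso N n).inv := by
  refine discX_hom_ext ?_ ?_
  · rw [discMap, discInl_discDesc]
    simp [discInl]
  · simp [discMap, discDesc]
    simp [discInr]

lemma discMap_f_comp_discXIso_hom {M N : ℤ → B} (φ : ∀ n, M n ⟶ N n) (n : ℤ) :
    (discMap φ).f n ≫ (discXIso N n).hom =
      (discXIso M n).hom ≫ biprod.map (φ n) (φ (n + 1)) := by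
  simp [discMap_f]

lemma discMap_comp_discDesc {M N : ℤ → B} {Y : ChainComplex B ℤ} (φ : ∀ n, M n ⟶ N n)
    (ψ : ∀ n, N n ⟶ Y.X n) : discMap φ ≫ discDesc ψ = discDesc fun n => φ n ≫ ψ n := by
  rw [discMap, discDesc_comp]
  simp

lemma discDesc_discInl_comp {M : ℤ → B} {Y : ChainComplex B ℤ} (f : disc M ⟶ Y) :
    discDesc (fun n => discInl M n ≫ f.f n) = f :=
  disc_hom_ext fun n => by simp

lemma projective_disc (M : ℤ → B) (hM : ∀ n, Projective (M n)) : Projective (disc M) where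
  factors {E X} f e he := by
    refine ⟨discDesc fun n => Projective.factorThru (discInl M n ≫ f.f n) (e.f n), ?_⟩
    rw [discDesc_comp]
    simp only [Projective.factorThru_comp, discDesc_discInl_comp]

lemma shortExact_disc {K P M : ℤ → B} {i : ∀ n, K n ⟶ P n} {p : ∀ n, P n ⟶ M n}
    {w : ∀ n, i n ≫ p n = 0} (h : ∀ n, (ShortComplex.mk (i n) (p n) (w n)).ShortExact) :
    ∃ w' : discMap i ≫ discMap p = 0, (ShortComplex.mk (discMap i) (discMap p) w').ShortExact := by
  have w' : discMap i ≫ discMap p = 0 := by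
    rw [discMap.eq_1 p, discMap_comp_discDesc]
    refine disc_hom_ext fun n => ?_
    rw [discInl_discDesc, ← Category.assoc, w, zero_comp, HomologicalComplex.zero_f, comp_zero]
  refine ⟨w', HomologicalComplex.shortExact_of_degreewise_shortExact _ fun n => ?_⟩
  let e : (ShortComplex.mk (discMap i) (discMap p) w').map (HomologicalComplex.eval _ _ n) ≅
      ShortComplex.mk (biprod.map (i n) (i (n + 1))) (biprod.map (p n) (p (n + 1)))
        (by ext <;> simp [w]) :=
    ShortComplex.isoMk (discXIso K n) (discXIso P n) (discXIso M n)
      (discMap_f_comp_discXIso_hom i n).symm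
      (discMap_f_comp_discXIso_hom p n).symm
  exact ShortComplex.shortExact_of_iso e.symm (shortExact_biprod_map (h n) (h (n + 1)))

/-- Degreewise projective presentations assemble to one of `disc M`, and by adjunction extending
maps along it is a degreewise problem. -/
lemma extOrtho_disc [EnoughProjectives B] [HasExt.{v} B] [HasExt.{v} (ChainComplex B ℤ)]
    {M : ℤ → B} {Y : ChainComplex B ℤ} (h : ∀ n, ExtOrtho (M n) (Y.X n)) :
    ExtOrtho (disc M) Y := by
  intro n
  induction n generalizing M with
  | zero =>
    have hS (n) : (ShortComplex.mk (kernel.ι (Projective.π (M n))) (Projective.π (M n))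
        (kernel.condition _)).ShortExact := ShortComplex.ShortExact.mk'
      (ShortComplex.kernelSequence_exact _) inferInstance inferInstance
    obtain ⟨w, hw⟩ := shortExact_disc hS
    have := projective_disc (fun n => Projective.over (M n)) inferInstance
    refine subsingleton_ext_one_of_exists_desc hw (extOrtho_of_projective _ _) fun k => ?_
    choose l hl using fun n => (h n).exists_desc (hS n)
      (discInl (fun n => kernel (Projective.π (M n))) n ≫ k.f n)
    refine ⟨discDesc l, ?_⟩
    rw [discMap_comp_discDesc]
    simp only [hl, discDesc_discInl_comp]
  | succ n ih =>
    have hS (n) : (ShortComplex.mk (kernel.ι (Projective.π (M n))) (Projective.π (M n))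
        (kernel.condition _)).ShortExact := ShortComplex.ShortExact.mk'
      (ShortComplex.kernelSequence_exact _) inferInstance inferInstance
    obtain ⟨w, hw⟩ := shortExact_disc hS
    have := projective_disc (fun n => Projective.over (M n)) inferInstance
    exact subsingleton_ext_succ ⟨_, _, _, hw⟩ (extOrtho_of_projective _ _) (ih fun n =>
      ExtOrtho.left₁ ⟨_, _, _, hS n⟩ (extOrtho_of_projective _ _) (h n))

instance (M : ℤ → B) (n : ℤ) : IsSplitEpi (discFst M n) := ⟨⟨discInl M n, by simp⟩⟩

instance (M : ℤ → B) (n : ℤ) : IsSplitMono (discInr M n) := ⟨⟨discSnd M n, by simp⟩⟩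

lemma disc_acyclic (M : ℤ → B) : (disc M).Acyclic := by
  intro j
  obtain ⟨i, rfl⟩ : ∃ i, j = i + 1 := ⟨j - 1, by lia⟩
  rw [HomologicalComplex.exactAt_iff' _ (i + 1 + 1) (i + 1) i (by simp) (by simp)]
  have hS : (ShortComplex.mk (discInr M (i + 1)) (discFst M (i + 1)) (by simp)).ShortExact :=
    ShortComplex.Splitting.shortExact
      { r := discSnd M (i + 1)
        s := discInl M (i + 1)
        id := by simp [add_comm, disc_total] }
  have := exact_splice hS (discFst M (i + 1 + 1)) (discInr M i) (by simp)
  simp only [HomologicalComplex.sc', HomologicalComplex.shortComplexFunctor', disc_d]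
  exact this

lemma nonempty_disc_cycles_iso (M : ℤ → B) (n : ℤ) :
    Nonempty ((disc M).cycles n ≅ M (n + 1)) := by
  have : Epi ((disc M).toCycles (n + 1) n) :=
    (shortExact_cycles (disc M) (i := n + 1) (j := n) (by simp) (disc_acyclic M n)).epi_g
  have := strongEpi_of_epi ((disc M).toCycles (n + 1) n)
  have := strongEpi_of_epi (discFst M (n + 1))
  exact ⟨image.isoStrongEpiMono _ _ ((disc M).toCycles_i (n + 1) n) ≪≫
    (image.isoStrongEpiMono _ _ (disc_d M n).symm).symm⟩

/-! ### Acyclic complexes with Ext-orthogonal cycles -/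

lemma isSES_cycles {X : ChainComplex B ℤ} (hX : X.Acyclic) (n : ℤ) :
    IsSES (X.cycles (n + 1)) (X.X (n + 1)) (X.cycles n) :=
  ⟨_, _, _, shortExact_cycles X (i := n + 1) (j := n) (by simp) (hX n)⟩

/-- Orthogonality splits the sequences of cycles, so X is contractible with homotopy `r n ≫ s n`,
and the canonical map `disc X.X ⟶ X` acquires a section. -/
lemma nonempty_retract_disc [HasExt.{v} B] {X : ChainComplex B ℤ} (hX : X.Acyclic)
    (h : ∀ i j, ExtOrtho (X.cycles i) (X.cycles j)) : Nonempty (Retract X (disc X.X)) := by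
  have hr (n) : ∃ r : X.X n ⟶ X.cycles n, X.iCycles n ≫ r = 𝟙 _ := by
    obtain ⟨m, rfl⟩ : ∃ m, n = m + 1 := ⟨n - 1, by lia⟩
    exact (h _ _).exists_desc (shortExact_cycles X (i := m + 1) (j := m) (by simp) (hX m)) _
  choose r hr using hr
  have hs (n) : ∃ s : X.cycles n ⟶ X.X (n + 1), s ≫ X.toCycles (n + 1) n = 𝟙 _ ∧
      r (n + 1) ≫ X.iCycles (n + 1) + X.toCycles (n + 1) n ≫ s = 𝟙 _ := by
    have hS := shortExact_cycles X (i := n + 1) (j := n) (by simp) (hX n)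
    let σ := ShortComplex.Splitting.ofExactOfRetraction _ hS.exact (r (n + 1)) (hr _) hS.epi_g
    exact ⟨σ.s, σ.s_g, σ.id⟩
  choose s hs hrs using hs
  -- The projection onto the chosen complement of the cycles. The section has components `a n` and
  -- the homotopy; composed back, they give `a n + r n ≫ X.iCycles n = 𝟙`.
  let a (n : ℤ) : X.X n ⟶ X.X n := 𝟙 _ - r n ≫ X.iCycles n
  have ha (n) : a (n + 1) = X.toCycles (n + 1) n ≫ s n := by
    simp only [a]
    rw [← hrs n, add_sub_cancel_left]
  have hda (n) : X.d (n + 1) n ≫ a n = 0 := by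
    rw [← X.toCycles_i (n + 1) n, Category.assoc, Preadditive.comp_sub, reassoc_of% (hr n),
      Category.comp_id, sub_self, comp_zero]
  have hdr (n) : X.d (n + 1) n ≫ r n ≫ s n = a (n + 1) := by
    rw [ha, ← X.toCycles_i (n + 1) n, Category.assoc, reassoc_of% (hr n)]
  refine ⟨⟨⟨fun n => a n ≫ discInl X.X n + r n ≫ s n ≫ discInr X.X n, ?_⟩,
    discDesc fun n => 𝟙 _, ?_⟩⟩
  · rintro _ n rfl
    simp [reassoc_of% (hda n), reassoc_of% (hdr n)]
  · ext n
    have hsd : s n ≫ X.d (n + 1) n = X.iCycles n := by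
      rw [← X.toCycles_i (n + 1) n, reassoc_of% (hs n)]
    simp [discDesc, hsd, a]

lemma extOrtho_of_acyclic [EnoughProjectives B] [HasExt.{v} B] [HasExt.{v} (ChainComplex B ℤ)]
    {X Y : ChainComplex B ℤ} (hX : X.Acyclic) (hXX : ∀ i j, ExtOrtho (X.cycles i) (X.cycles j))
    (hXY : ∀ n, ExtOrtho (X.X n) (Y.X n)) : ExtOrtho X Y :=
  (extOrtho_disc hXY).of_retract_left (nonempty_retract_disc hX hXX).some

/-- The cycles of a biproduct of complexes. -/
lemma nonempty_cycles_biprod_iso (X Y : ChainComplex B ℤ) (n : ℤ) :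
    Nonempty ((X ⊞ Y).cycles n ≅ X.cycles n ⊞ Y.cycles n) := by
  have h₁ : HomologicalComplex.cyclesMap (biprod.inl : X ⟶ X ⊞ Y) n ≫
      HomologicalComplex.cyclesMap (biprod.snd : X ⊞ Y ⟶ Y) n = 0 := by
    rw [← HomologicalComplex.cyclesMap_comp, biprod.inl_snd, HomologicalComplex.cyclesMap_zero]
  let σ : (ShortComplex.mk _ _ h₁).Splitting :=
    { r := HomologicalComplex.cyclesMap (biprod.fst : X ⊞ Y ⟶ X) n
      s := HomologicalComplex.cyclesMap (biprod.inr : Y ⟶ X ⊞ Y) n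
      f_r := by
        dsimp
        rw [← HomologicalComplex.cyclesMap_comp, biprod.inl_fst, HomologicalComplex.cyclesMap_id]
      s_g := by
        dsimp
        rw [← HomologicalComplex.cyclesMap_comp, biprod.inr_snd, HomologicalComplex.cyclesMap_id]
      id := by
        dsimp
        rw [← cancel_mono ((X ⊞ Y).iCycles n)]
        have := congrArg (fun f => f.f n) (biprod.total (X := X) (Y := Y))
        simp only [HomologicalComplex.add_f_apply, HomologicalComplex.comp_f,
          HomologicalComplex.id_f] at this
        simp [← Preadditive.comp_add, this] }
  exact ⟨σ.isoBinaryBiproduct⟩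

lemma acyclic_biprod {X Y : ChainComplex B ℤ} (hX : X.Acyclic) (hY : Y.Acyclic) :
    (X ⊞ Y).Acyclic :=
  (ShortComplex.Splitting.ofHasBinaryBiproduct X Y).shortExact.acyclic_X₂ hX hY

end Disc

section Modules

variable {R : Type u} [CommRing R]

/-! ### Complexes with cycles in a class of modules -/

instance (C : ModuleCat.{u} R) : (cProjMod C).IsClosedUnderIsomorphisms where
  of_iso := by
    rintro X Y e ⟨P, hP, ⟨e'⟩⟩
    exact ⟨P, hP, ⟨e.symm.toLinearEquiv ≪≫ₗ e'⟩⟩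

instance : (projMod : ObjectProperty (ModuleCat.{u} R)).IsClosedUnderIsomorphisms where
  of_iso := by
    intro X Y e (hX : Module.Projective R X)
    exact Module.Projective.of_equiv e.toLinearEquiv

lemma cProjMod_biprod {C M N : ModuleCat.{u} R} (hM : cProjMod C M) (hN : cProjMod C N) :
    cProjMod C (M ⊞ N) := by
  obtain ⟨P, hP, ⟨e⟩⟩ := hM
  obtain ⟨Q, hQ, ⟨e'⟩⟩ := hN
  exact ⟨ModuleCat.of R (P × Q), inferInstanceAs (Module.Projective R (P × Q)),
    ⟨(ModuleCat.biprodIsoProd M N).toLinearEquiv ≪≫ₗ e.prodCongr e' ≪≫ₗ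
      (TensorProduct.prodRight R R C P Q).symm⟩⟩

lemma cProjMod_of_isZero (C : ModuleCat.{u} R) {M : ModuleCat.{u} R} (hM : IsZero M) :
    cProjMod C M := by
  have := ModuleCat.subsingleton_of_isZero hM
  exact ⟨M, Module.Projective.of_free, ⟨0⟩⟩

instance (𝓧 : ObjectProperty (ModuleCat.{u} R)) [𝓧.IsClosedUnderIsomorphisms] :
    (tilde 𝓧).IsClosedUnderIsomorphisms where
  of_iso := by
    rintro X Y e ⟨hX, hX'⟩
    exact ⟨fun i => (hX i).of_iso e,
      fun i => 𝓧.prop_of_iso ((HomologicalComplex.cyclesFunctor _ _ i).mapIso e) (hX' i)⟩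

lemma tilde_biprod {𝓧 : ObjectProperty (ModuleCat.{u} R)} [𝓧.IsClosedUnderIsomorphisms]
    (h : ∀ M N, 𝓧 M → 𝓧 N → 𝓧 (M ⊞ N)) {X Y : Ch R} (hX : tilde 𝓧 X) (hY : tilde 𝓧 Y) :
    tilde 𝓧 (X ⊞ Y) :=
  ⟨acyclic_biprod hX.1 hY.1, fun i =>
    𝓧.prop_of_iso (nonempty_cycles_biprod_iso X Y i).some.symm (h _ _ (hX.2 i) (hY.2 i))⟩

lemma isZero_cycles_of_isZero {X : Ch R} (hX : IsZero X) (i : ℤ) : IsZero (X.cycles i) :=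
  (Functor.map_isZero (HomologicalComplex.eval _ _ i) hX).of_mono (X.iCycles i)

lemma tilde_of_isZero {𝓧 : ObjectProperty (ModuleCat.{u} R)} (h : ∀ M, IsZero M → 𝓧 M)
    {X : Ch R} (hX : IsZero X) : tilde 𝓧 X :=
  ⟨fun i => ShortComplex.exact_of_isZero_X₂ _
    (Functor.map_isZero (HomologicalComplex.eval _ _ i) hX),
    fun i => h _ (isZero_cycles_of_isZero hX i)⟩

lemma tilde_mono {𝓧 𝓨 : ObjectProperty (ModuleCat.{u} R)} (h : ∀ M, 𝓧 M → 𝓨 M) {X : Ch R}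
    (hX : tilde 𝓧 X) : tilde 𝓨 X :=
  ⟨hX.1, fun i => h _ (hX.2 i)⟩

/-- Each term is an extension of cycle modules, in both variables. -/
lemma extOrtho_X_of_tilde {𝓧 𝓨 : ObjectProperty (ModuleCat.{u} R)}
    (h : ∀ M N, 𝓧 M → 𝓨 N → ExtOrtho M N) {X Y : Ch R} (hX : tilde 𝓧 X) (hY : tilde 𝓨 Y)
    (i j : ℤ) : ExtOrtho (X.X i) (Y.X j) := by
  obtain ⟨i, rfl⟩ : ∃ k, i = k + 1 := ⟨i - 1, by lia⟩
  obtain ⟨j, rfl⟩ : ∃ k, j = k + 1 := ⟨j - 1, by lia⟩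
  have key (M) (hM : 𝓧 M) : ExtOrtho M (Y.X (j + 1)) :=
    ExtOrtho.right₂ (isSES_cycles hY.1 j) (h _ _ hM (hY.2 _)) (h _ _ hM (hY.2 _))
  exact ExtOrtho.left₂ (isSES_cycles hX.1 i) (key _ (hX.2 _)) (key _ (hX.2 _))

lemma extOrtho_of_tilde {𝓧 𝓨 : ObjectProperty (ModuleCat.{u} R)}
    (h𝓧 : ∀ M N, 𝓧 M → 𝓧 N → ExtOrtho M N) (h : ∀ M N, 𝓧 M → 𝓨 N → ExtOrtho M N) {X Y : Ch R}
    (hX : tilde 𝓧 X) (hY : tilde 𝓨 Y) : ExtOrtho X Y :=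
  extOrtho_of_acyclic hX.1 (fun _ _ => h𝓧 _ _ (hX.2 _) (hX.2 _))
    fun n => extOrtho_X_of_tilde h hX hY n n

lemma extOrtho_of_projMod {M : ModuleCat.{u} R} (hM : projMod M) (N : ModuleCat.{u} R) :
    ExtOrtho M N :=
  have := (IsProjective.iff_projective M).1 hM
  extOrtho_of_projective M N

lemma exists_tilde_projMod_presentation (X : Ch R) :
    ∃ P K : Ch R, tilde projMod P ∧ IsSES K P X := by
  let p : disc (fun n => Projective.over (X.X n)) ⟶ X := discDesc fun n => Projective.π (X.X n)
  have hp (n) : Epi (p.f n) := by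
    have : Epi (discInl _ n ≫ p.f n) := by
      rw [discInl_discDesc]
      infer_instance
    exact epi_of_epi (discInl _ n) (p.f n)
  have : Epi p := HomologicalComplex.epi_of_epi_f p hp
  refine ⟨_, kernel p, ⟨disc_acyclic _, fun i => ?_⟩, kernel.ι p, p, kernel.condition p,
    ShortComplex.ShortExact.mk' (ShortComplex.kernelSequence_exact _) inferInstance this⟩
  refine projMod.prop_of_iso (nonempty_disc_cycles_iso _ i).some.symm ?_
  exact (IsProjective.iff_projective _).2 (Projective.projective_over _)

lemma isRelativeGorenstein_dcProjective {C : ModuleCat.{u} R} (hC : IsSemidualizing C) :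
    IsRelativeGorenstein (tilde (cProjMod C)) (DCProjective C) :=
  isRelativeGorenstein_hasCompleteResolution
    (fun _ _ => extOrtho_of_tilde (fun _ _ h _ => extOrtho_of_projMod h _)
      fun _ _ h _ => extOrtho_of_projMod h _)
    (fun _ _ => extOrtho_of_tilde (fun _ _ h h' => hC.extOrtho h (cProjMod_le_cFlatMod C h'))
      fun _ _ => hC.extOrtho)
    exists_tilde_projMod_presentation (fun _ => tilde_mono fun _ => cProjMod_le_cFlatMod C)
    (tilde_of_isZero (fun _ => cProjMod_of_isZero C) (isZero_zero _))
    fun _ _ => tilde_biprod fun _ _ => cProjMod_biprod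

end Modules

end RelDing

theorem corollary3p5 {R : Type u} [CommRing R] (C : ModuleCat.{u} R)
    (hC : RelDing.IsSemidualizing C) (X : RelDing.Ch R) (n : ℕ)
    (hX : RelDing.dcPd C X = (n : ℕ∞)) :
    (∃ (Y G : RelDing.Ch R) (i : X ⟶ Y) (p : Y ⟶ G) (w : i ≫ p = 0),
      (ShortComplex.mk i p w).ShortExact ∧ RelDing.DCProjective C G ∧
        RelDing.pcPd C Y = (n : ℕ∞)) ∧
    (∃ (K G : RelDing.Ch R) (i : K ⟶ G) (p : G ⟶ X),
      RelDing.IsSpecialPrecover (RelDing.DCProjective C) i p ∧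
        (0 < n → RelDing.pcPd C K = ((n - 1 : ℕ) : ℕ∞)) ∧
        (n = 0 → IsZero K)) :=
  ⟨(RelDing.isRelativeGorenstein_dcProjective hC).exists_hull_of_resolutionDim_eq hX,
    (RelDing.isRelativeGorenstein_dcProjective hC).exists_isSpecialPrecover_of_resolutionDim_eq hX⟩
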